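/- Let $L$ be a compact connected smooth manifold (without boundary), let $\varphi\in\mathrm{Diff}(L)$, and let $\alpha\in\Omega^1(L)$ be a closed nowhere-vanishing one-form with $\varphi^*\alpha=e^{\lambda}\alpha$ for some real $\lambda\neq 0$. On the mapping torus $\mathbb{T}_\varphi=(L\times\mathbb{R})/\big((x,t)\sim(\varphi(x),t+1)\big)$ consider the one-forms $\omega_1,\omega_2\in\Omega^1(\mathbb{T}_\varphi)$ induced by $e^{-\lambda t}\alpha$ and $-\lambda\,dt$. They are linearly independent at every point, satisfy $d\omega_1=\omega_2\wedge\omega_1$ and $d\omega_2=0$, and define the model Lie affine foliation $\mathcal{G}_{\alpha,\lambda}$ with tangent distribution $T\mathcal{G}_{\alpha,\lambda}=\ker\omega_1\cap\ker\omega_2$. For a closed one-form $\theta$ on a manifold $M$, let $H^\bullet_\theta(M)$ be the Morse–Novikov cohomology, i.e. the cohomology of $\Omega^\bullet(M)$ with the differential $d_\theta\beta=d\beta-\theta\wedge\beta$. If $\zeta_1,\zeta_2\in\Omega^1(M)$ are linearly independent at every point with $d\zeta_1-\zeta_2\wedge\zeta_1=0$ and $d\zeta_2=0$, then $\zeta_1$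 defines a class $[\zeta_1]\in H^1_{\zeta_2}(M)$, and $[\gamma]\mapsto[\gamma\wedge\zeta_1]$ is a well-defined linear map $\bullet\wedge[\zeta_1]:H^1(M)\to H^2_{\zeta_2}(M)$ on de Rham cohomology. Say that the pair $(\zeta_1,\zeta_2)$ satisfies the cohomological conditions if $$H^1_{\zeta_2}(M)=\mathbb{R}[\zeta_1]\quad\text{and}\quad \bullet\wedge[\zeta_1]:H^1(M)\to H^2_{\zeta_2}(M)\ \text{is injective}.$$ Let $\zeta_1,\zeta_2\in\Omega^1(\mathbb{T}_\varphi)$ be any one-forms that are linearly independent at every point and satisfy $\ker\zeta_1\cap\ker\zeta_2=T\mathcal{G}_{\alpha,\lambda}$, $d\zeta_1-\zeta_2\wedge\zeta_1=0$ and $d\zeta_2=0$. Then $(\omega_1,\omega_2)$ satisfies the cohomological conditions if and only if $(\zeta_1,\zeta_2)$ does. Hence the conditions depend only on the foliation $\mathcal{G}_{\alpha,\lambda}$: any two pairs $(\zeta_1,\zeta_2)$ and $(\zeta_1',\zeta_2')$ as above either both satisfy them or both fail them. -/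

import Mathlib

open scoped ContDiff Manifold Topology

noncomputable section

set_option linter.unusedSectionVars false

namespace LieAffine

open ContinuousAlternatingMap

section Linear

variable {V W : Type*} [NormedAddCommGroup V] [NormedSpace ℝ V]
  [NormedAddCommGroup W] [NormedSpace ℝ W] {k : ℕ}

/-- The exterior product `θ ∧ β` of a one-form and a `k`-form on a vector space,
`(θ ∧ β)(v₀, …, v_k) = ∑ i, (-1)^i θ(v_i) β(v₀, …, v̂_i, …, v_k)`. -/
def wedge (θ : V [⋀^Fin 1]→L[ℝ] ℝ) (β : V [⋀^Fin k]→L[ℝ] ℝ) : V [⋀^Fin (k + 1)]→L[ℝ] ℝ :=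
  alternatizeUncurryFin
    (((ofSubsingletonLIE (𝕜 := ℝ) (E := V) (F := ℝ) (0 : Fin 1)).symm θ).smulRight β)

lemma wedge_apply (θ : V [⋀^Fin 1]→L[ℝ] ℝ) (β : V [⋀^Fin k]→L[ℝ] ℝ) (v : Fin (k + 1) → V) :
    wedge θ β v = ∑ i : Fin (k + 1), (-1 : ℤ) ^ (i : ℕ) • (θ (fun _ => v i) * β (i.removeNth v)) := by
  simp only [wedge, alternatizeUncurryFin_apply, ContinuousLinearMap.smulRight_apply,
    ContinuousAlternatingMap.smul_apply, smul_eq_mul]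
  rfl

lemma wedge_comp (A : W →L[ℝ] V) (θ : V [⋀^Fin 1]→L[ℝ] ℝ) (β : V [⋀^Fin k]→L[ℝ] ℝ) :
    (wedge θ β).compContinuousLinearMap A =
      wedge (θ.compContinuousLinearMap A) (β.compContinuousLinearMap A) := by
  ext v
  simp only [compContinuousLinearMap_apply, wedge_apply]
  rfl

/-- `wedge` as a continuous bilinear map. -/
def wedgeL (V : Type*) [NormedAddCommGroup V] [NormedSpace ℝ V] (k : ℕ) :
    (V [⋀^Fin 1]→L[ℝ] ℝ) →L[ℝ] (V [⋀^Fin k]→L[ℝ] ℝ) →L[ℝ] (V [⋀^Fin (k + 1)]→L[ℝ] ℝ) :=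
  (ContinuousLinearMap.compL ℝ (V [⋀^Fin k]→L[ℝ] ℝ) (V →L[ℝ] V [⋀^Fin k]→L[ℝ] ℝ)
      (V [⋀^Fin (k + 1)]→L[ℝ] ℝ) (alternatizeUncurryFinCLM ℝ V ℝ)) ∘L
    (ContinuousLinearMap.smulRightL ℝ V (V [⋀^Fin k]→L[ℝ] ℝ)) ∘L
    ((ofSubsingletonLIE (𝕜 := ℝ) (E := V) (F := ℝ)
      (0 : Fin 1)).symm.toContinuousLinearEquiv : (V [⋀^Fin 1]→L[ℝ] ℝ) →L[ℝ] (V →L[ℝ] ℝ))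

lemma wedgeL_apply (θ : V [⋀^Fin 1]→L[ℝ] ℝ) (β : V [⋀^Fin k]→L[ℝ] ℝ) :
    wedgeL V k θ β = wedge θ β := rfl

/-- The value of a zero-form, a real number. -/
def zval (V : Type*) [NormedAddCommGroup V] [NormedSpace ℝ V] : (V [⋀^Fin 0]→L[ℝ] ℝ) →L[ℝ] ℝ :=
  ((constOfIsEmptyLIE ℝ V ℝ (Fin 0)).symm.toContinuousLinearEquiv :
    (V [⋀^Fin 0]→L[ℝ] ℝ) →L[ℝ] ℝ)

lemma zval_apply (g : V [⋀^Fin 0]→L[ℝ] ℝ) (v : Fin 0 → V) : zval V g = g v := by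
  rw [Subsingleton.elim v 0]; rfl

lemma zval_comp (A : W →L[ℝ] V) (g : V [⋀^Fin 0]→L[ℝ] ℝ) :
    zval W (g.compContinuousLinearMap A) = zval V g := by
  rw [zval_apply _ 0, compContinuousLinearMap_apply, ← zval_apply]

lemma zsmul_comp (A : W →L[ℝ] V) (g : V [⋀^Fin 0]→L[ℝ] ℝ) (β : V [⋀^Fin k]→L[ℝ] ℝ) :
    (zval V g • β).compContinuousLinearMap A =
      zval W (g.compContinuousLinearMap A) • β.compContinuousLinearMap A := by
  rw [zval_comp]; rfl

lemma altAlt_add_swap (f g : V →L[ℝ] V →L[ℝ] V [⋀^Fin k]→L[ℝ] ℝ) (h : ∀ x y, f x y = g y x) :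
    alternatizeUncurryFin (alternatizeUncurryFinCLM ℝ V ℝ ∘L f) =
      - alternatizeUncurryFin (alternatizeUncurryFinCLM ℝ V ℝ ∘L g) := by
  rw [eq_neg_iff_add_eq_zero, ← alternatizeUncurryFin_add, ← ContinuousLinearMap.comp_add]
  apply alternatizeUncurryFin_alternatizeUncurryFinCLM_comp_of_symmetric
  intro x y
  simp [h, add_comm]

lemma wedge_wedge (θ η : V [⋀^Fin 1]→L[ℝ] ℝ) (β : V [⋀^Fin k]→L[ℝ] ℝ) :
    wedge θ (wedge η β) = - wedge η (wedge θ β) := by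
  let L := (ofSubsingletonLIE (𝕜 := ℝ) (E := V) (F := ℝ) (0 : Fin 1)).symm
  have key : ∀ a b : V [⋀^Fin 1]→L[ℝ] ℝ, wedge a (wedge b β) =
      alternatizeUncurryFin (alternatizeUncurryFinCLM ℝ V ℝ ∘L
        ((L a).smulRight ((L b).smulRight β))) := by
    intro a b
    simp only [wedge]
    congr 1
    ext v : 1
    simp [L]
  rw [key, key]
  apply altAlt_add_swap
  intro x y
  simp [smul_smul, mul_comm]

lemma extDeriv_wedge {θ : V → V [⋀^Fin 1]→L[ℝ] ℝ} {β : V → V [⋀^Fin k]→L[ℝ] ℝ} {x : V}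
    (hθ : DifferentiableAt ℝ θ x) (hβ : DifferentiableAt ℝ β x) (h : extDeriv θ x = 0) :
    extDeriv (fun y => wedge (θ y) (β y)) x = - wedge (θ x) (extDeriv β x) := by
  let L : (V [⋀^Fin 1]→L[ℝ] ℝ) ≃L[ℝ] (V →L[ℝ] ℝ) := (ofSubsingletonLIE (𝕜 := ℝ) (E := V) (F := ℝ)
      (0 : Fin 1)).symm.toContinuousLinearEquiv
  have hsym : ∀ v w, L (fderiv ℝ θ x v) w = L (fderiv ℝ θ x w) v := by
    intro v w
    have h2 := congrArg (fun a => a ![v, w]) h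
    simp [extDeriv, alternatizeUncurryFin_apply, Fin.sum_univ_two] at h2
    have e1 : (![w] : Fin 1 → V) = fun _ => w := by ext i; fin_cases i; rfl
    have e2 : (Fin.removeNth 1 ![v, w] : Fin 1 → V) = fun _ => v := by ext i; fin_cases i; rfl
    rw [e2, e1] at h2
    exact add_neg_eq_zero.1 h2
  have h1 : HasFDerivAt (fun y => wedge (θ y) (β y))
      ((wedgeL V k (θ x)) ∘L fderiv ℝ β x + ((wedgeL V k).flip (β x)) ∘L fderiv ℝ θ x) x := by
    have := (wedgeL V k).hasFDerivAt_of_bilinear hθ.hasFDerivAt hβ.hasFDerivAt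
    convert! this using 1
  rw [extDeriv, h1.fderiv, alternatizeUncurryFin_add]
  have e1 : (wedgeL V k (θ x)) ∘L fderiv ℝ β x = alternatizeUncurryFinCLM ℝ V ℝ ∘L
      ((ContinuousLinearMap.smulRightL ℝ V (V [⋀^Fin k]→L[ℝ] ℝ) (L (θ x))) ∘L fderiv ℝ β x) := rfl
  have e2 : ((wedgeL V k).flip (β x)) ∘L fderiv ℝ θ x = alternatizeUncurryFinCLM ℝ V ℝ ∘L
      (((ContinuousLinearMap.smulRightL ℝ V (V [⋀^Fin k]→L[ℝ] ℝ)).flip (β x)) ∘L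
        (L : (V [⋀^Fin 1]→L[ℝ] ℝ) →L[ℝ] (V →L[ℝ] ℝ)) ∘L fderiv ℝ θ x) := rfl
  have z2 : alternatizeUncurryFin (((wedgeL V k).flip (β x)) ∘L fderiv ℝ θ x) = 0 := by
    rw [e2]
    apply alternatizeUncurryFin_alternatizeUncurryFinCLM_comp_of_symmetric
    intro v w
    simp [hsym v w]
  rw [z2, add_zero, e1, altAlt_add_swap _ ((L (θ x)).smulRight (fderiv ℝ β x))]
  · congr 1
    rw [wedge]
    congr 1
    ext v : 1
    simp [extDeriv]
    rfl
  · intro v w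
    simp

lemma extDeriv_zsmul {g : V → V [⋀^Fin 0]→L[ℝ] ℝ} {β : V → V [⋀^Fin k]→L[ℝ] ℝ} {x : V}
    (hg : DifferentiableAt ℝ g x) (hβ : DifferentiableAt ℝ β x) :
    extDeriv (fun y => zval V (g y) • β y) x =
      wedge (extDeriv g x) (β x) + zval V (g x) • extDeriv β x := by
  have h1 : HasFDerivAt (fun y => zval V (g y)) (zval V ∘L fderiv ℝ g x) x :=
    (zval V).hasFDerivAt.comp x hg.hasFDerivAt
  rw [extDeriv, (h1.fun_smul hβ.hasFDerivAt).fderiv, alternatizeUncurryFin_add, add_comm (alternatizeUncurryFin _)]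
  congr 1
  · rw [wedge]
    congr 1
    ext v : 1
    have e : zval V (fderiv ℝ g x v) = extDeriv g x (fun _ => v) := by
      have e1 : extDeriv g x (fun _ => v) = ∑ i : Fin 1, (-1 : ℤ) ^ (i : ℕ) •
          fderiv ℝ g x v (i.removeNth fun _ => v) := alternatizeUncurryFin_apply _ _
      rw [e1, zval_apply _ (Fin.tail fun _ => v)]
      simp
    simp [e]
  · rw [alternatizeUncurryFin_smul]; rfl

/-- Continuous left inverse of the inclusion of alternating maps into multilinear maps. -/
def altProj (V : Type*) [NormedAddCommGroup V] [NormedSpace ℝ V] (k : ℕ) :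
    ContinuousMultilinearMap ℝ (fun _ : Fin k => V) ℝ →L[ℝ] (V [⋀^Fin k]→L[ℝ] ℝ) :=
  liftCLM ((k.factorial : ℝ)⁻¹ • ∑ σ : Equiv.Perm (Fin k), ((Equiv.Perm.sign σ : ℤ) : ℝ) •
    ((ContinuousMultilinearMap.domDomCongrₗᵢ ℝ V ℝ σ).toContinuousLinearEquiv :
      ContinuousMultilinearMap ℝ (fun _ : Fin k => V) ℝ →L[ℝ] _)) (by
    intro f v i j hv hij
    have := (ContinuousMultilinearMap.alternatization f).map_eq_zero_of_eq v hv hij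
    rw [ContinuousMultilinearMap.alternatization_apply_apply] at this
    have e : ∀ σ : Equiv.Perm (Fin k), (ContinuousMultilinearMap.domDomCongrₗᵢ ℝ V ℝ σ) f v =
      f (v ∘ σ) := fun _ => rfl
    simp [e]
    right
    simpa [Units.smul_def] using this)

lemma altProj_coe (f : V [⋀^Fin k]→L[ℝ] ℝ) : altProj V k f.toContinuousMultilinearMap = f := by
  ext v
  have e : ∀ σ : Equiv.Perm (Fin k), (ContinuousMultilinearMap.domDomCongrₗᵢ ℝ V ℝ σ)
      f.toContinuousMultilinearMap v = (Equiv.Perm.sign σ : ℤ) * f v := by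
    intro σ
    have := f.toAlternatingMap.map_perm v σ
    simp [Units.smul_def] at this
    exact this
  have e2 : ∀ σ : Equiv.Perm (Fin k), ((Equiv.Perm.sign σ : ℤ) : ℝ) * (Equiv.Perm.sign σ : ℤ) = 1 := by
    intro σ
    rcases Int.units_eq_one_or (Equiv.Perm.sign σ) with h | h <;> simp [h]
  simp [altProj, e, ← mul_assoc, e2, Fintype.card_perm]
  rw [inv_mul_cancel₀ (by positivity), one_mul]

lemma contDiff_comp : ContDiff ℝ ∞ (fun p : (V [⋀^Fin k]→L[ℝ] ℝ) × (W →L[ℝ] V) =>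
    p.1.compContinuousLinearMap p.2) := by
  have h : (fun p : (V [⋀^Fin k]→L[ℝ] ℝ) × (W →L[ℝ] V) => p.1.compContinuousLinearMap p.2) =
    fun p => altProj W k
      ((ContinuousMultilinearMap.compContinuousLinearMapContinuousMultilinear ℝ
        (fun _ : Fin k => W) (fun _ => V) ℝ (fun _ => p.2))
        (toContinuousMultilinearMapCLM ℝ p.1)) := by
    funext p
    rw [← altProj_coe (p.1.compContinuousLinearMap p.2)]
    rfl
  rw [h]
  refine (altProj W k).contDiff.comp (ContDiff.clm_apply ?_ ?_)
  · refine (ContinuousMultilinearMap.contDiff _).comp ?_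
    exact contDiff_pi.2 fun _ => contDiff_snd
  · exact (toContinuousMultilinearMapLI (𝕜 := ℝ) (ι := Fin k) (E := V) (F := ℝ)).toContinuousLinearMap.contDiff.comp contDiff_fst

end Linear

section Forms

variable {E : Type*} [NormedAddCommGroup E] [NormedSpace ℝ E] {H : Type*} [TopologicalSpace H]
  {E' : Type*} [NormedAddCommGroup E'] [NormedSpace ℝ E'] {H' : Type*} [TopologicalSpace H']
  {F : Type*} [NormedAddCommGroup F] [NormedSpace ℝ F]
  {E'' : Type*} [NormedAddCommGroup E''] [NormedSpace ℝ E''] {H'' : Type*} [TopologicalSpace H'']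
  {M : Type*} [TopologicalSpace M] [ChartedSpace H M]
  {M' : Type*} [TopologicalSpace M'] [ChartedSpace H' M']
  {M'' : Type*} [TopologicalSpace M''] [ChartedSpace H'' M'']
  (I : ModelWithCorners ℝ E H) (I' : ModelWithCorners ℝ E' H') (I'' : ModelWithCorners ℝ E'' H'')
  {k : ℕ}

/-- The pullback `f^* w` of a (not necessarily smooth) `k`-form along a map `f : M' → M`. A `k`-form
assigns to `x : M` an alternating `k`-linear form on the tangent space `TangentSpace I x`, which is
by definition the model space `E`. -/
def pull (f : M' → M) (w : M → E [⋀^Fin k]→L[ℝ] ℝ) : M' → E' [⋀^Fin k]→L[ℝ] ℝ :=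
  fun x => (w (f x)).compContinuousLinearMap (mfderiv I' I f x : E' →L[ℝ] E)

/-- The expression of a `k`-form in the preferred chart at `x₀`. -/
def inChart (x₀ : M) (w : M → E [⋀^Fin k]→L[ℝ] ℝ) : E → E [⋀^Fin k]→L[ℝ] ℝ :=
  pull I 𝓘(ℝ, E) (extChartAt I x₀).symm w

/-- The exterior derivative of a form, computed at `x` in the preferred chart at `x`. -/
def rawD (w : M → E [⋀^Fin k]→L[ℝ] ℝ) : M → E [⋀^Fin (k + 1)]→L[ℝ] ℝ :=
  fun x => (extDeriv (inChart I x w) (extChartAt I x x)).compContinuousLinearMap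
    (mfderiv I 𝓘(ℝ, E) (extChartAt I x) x : E →L[ℝ] E)

lemma inChart_add (x₀ : M) (w w' : M → E [⋀^Fin k]→L[ℝ] ℝ) :
    inChart I x₀ (w + w') = inChart I x₀ w + inChart I x₀ w' := rfl

lemma inChart_smul (x₀ : M) (c : ℝ) (w : M → E [⋀^Fin k]→L[ℝ] ℝ) :
    inChart I x₀ (c • w) = c • inChart I x₀ w := rfl

/-- The space of `k`-forms that are smooth in all charts. -/
def smoothForms (M : Type*) [TopologicalSpace M] [ChartedSpace H M] (k : ℕ) :
    Submodule ℝ (M → E [⋀^Fin k]→L[ℝ] ℝ) where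
  carrier := {w | ∀ x₀ : M, ContDiffOn ℝ ∞ (inChart I x₀ w) (extChartAt I x₀).target}
  add_mem' := fun h h' x₀ => (h x₀).add (h' x₀)
  zero_mem' := fun _ => contDiffOn_const (c := 0)
  smul_mem' := fun c _ h x₀ => (h x₀).const_smul c

/-- `Ω^k(M)`, the smooth differential `k`-forms on `M`. -/
structure Form (M : Type*) [TopologicalSpace M] [ChartedSpace H M] (k : ℕ) where
  /-- the underlying family of alternating forms on the tangent spaces -/
  toFun : M → E [⋀^Fin k]→L[ℝ] ℝ
  smooth : toFun ∈ smoothForms I M k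

/-- `Form I M k` as a subspace of all families of alternating forms. -/
def Form.equiv : Form I M k ≃ smoothForms I M k where
  toFun w := ⟨w.1, w.2⟩
  invFun w := ⟨w.1, w.2⟩

instance : AddCommGroup (Form I M k) := (Form.equiv I).addCommGroup

instance : Module ℝ (Form I M k) := (Form.equiv I).module ℝ

variable {I} in
@[ext]
lemma Form.ext {w w' : Form I M k} (h : w.toFun = w'.toFun) : w = w' := by
  cases w; cases w'; congr

@[simp] lemma Form.add_toFun (w w' : Form I M k) : (w + w').toFun = w.toFun + w'.toFun := rfl
@[simp] lemma Form.neg_toFun (w : Form I M k) : (-w).toFun = -w.toFun := rfl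
@[simp] lemma Form.sub_toFun (w w' : Form I M k) : (w - w').toFun = w.toFun - w'.toFun := rfl
@[simp] lemma Form.smul_toFun (c : ℝ) (w : Form I M k) : (c • w).toFun = c • w.toFun := rfl
@[simp] lemma Form.zero_toFun : (0 : Form I M k).toFun = 0 := rfl

variable {I I' I''}

lemma two_le_infty : minSmoothness ℝ 2 ≤ (∞ : WithTop ℕ∞) := by
  rw [minSmoothness_of_isRCLikeNormedField]
  exact WithTop.coe_le_coe.2 (le_top : (2 : ℕ∞) ≤ ⊤)

lemma pull_comp {g : M' → M} {f : M'' → M'} (w : M → E [⋀^Fin k]→L[ℝ] ℝ) {x : M''}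
    (hg : MDifferentiableAt I' I g (f x)) (hf : MDifferentiableAt I'' I' f x) :
    pull I I'' (g ∘ f) w x = pull I' I'' f (pull I I' g w) x := by
  simp only [pull, mfderiv_comp x hg hf]
  rfl

lemma pull_congr {f g : M' → M} (w : M → E [⋀^Fin k]→L[ℝ] ℝ) {x : M'} (h : f =ᶠ[𝓝 x] g) :
    pull I I' f w x = pull I I' g w x := by
  simp only [pull, h.mfderiv_eq, h.self_of_nhds]

variable [IsManifold I ∞ M] [I.Boundaryless]

set_option linter.unusedSectionVars false

lemma pull_eventuallyEq {f : F → M} {U : Set F} (hU : IsOpen U)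
    (hf : ContMDiffOn 𝓘(ℝ, F) I ∞ f U) (w : M → E [⋀^Fin k]→L[ℝ] ℝ) {y : F} (hy : y ∈ U) :
    ∃ V ∈ 𝓝 y, IsOpen V ∧ V ⊆ U ∧ ContDiffOn ℝ ∞ (extChartAt I (f y) ∘ f) V ∧
      (∀ z ∈ V, extChartAt I (f y) (f z) ∈ (extChartAt I (f y)).target) ∧
      ∀ z ∈ V, pull I 𝓘(ℝ, F) f w z =
        (inChart I (f y) w (extChartAt I (f y) (f z))).compContinuousLinearMap
          (fderiv ℝ (extChartAt I (f y) ∘ f) z) := by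
  let c := extChartAt I (f y)
  let V := U ∩ f ⁻¹' c.source
  have hV : IsOpen V := hf.continuousOn.isOpen_inter_preimage hU (isOpen_extChartAt_source (f y))
  have hyV : y ∈ V := ⟨hy, mem_extChartAt_source (f y)⟩
  have hcf : ContMDiffOn 𝓘(ℝ, F) 𝓘(ℝ, E) ∞ (c ∘ f) V := by
    refine (contMDiffOn_extChartAt (I := I) (x := f y)).comp (hf.mono Set.inter_subset_left) ?_
    intro z hz
    have := hz.2
    rwa [Set.mem_preimage, extChartAt_source] at this
  refine ⟨V, hV.mem_nhds hyV, hV, Set.inter_subset_left, contMDiffOn_iff_contDiffOn.1 hcf,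
    fun z hz => c.map_source hz.2, ?_⟩
  intro z hz
  have h1 : f =ᶠ[𝓝 z] c.symm ∘ (c ∘ f) := by
    filter_upwards [hV.mem_nhds hz] with u hu
    exact (c.left_inv hu.2).symm
  rw [pull_congr w h1, pull_comp (I' := 𝓘(ℝ, E)) w, pull, mfderiv_eq_fderiv]
  · rfl
  · refine ((contMDiffOn_extChartAt_symm (I := I) (n := ∞) (f y)).contMDiffAt ?_).mdifferentiableAt
      (by simp)
    exact (isOpen_extChartAt_target (f y)).mem_nhds (c.map_source hz.2)
  · exact (hcf.contMDiffAt (hV.mem_nhds hz)).mdifferentiableAt (by simp)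

lemma contDiffOn_pull {f : F → M} {U : Set F} (hU : IsOpen U)
    (hf : ContMDiffOn 𝓘(ℝ, F) I ∞ f U) {w : M → E [⋀^Fin k]→L[ℝ] ℝ} (hw : w ∈ smoothForms I M k) :
    ContDiffOn ℝ ∞ (pull I 𝓘(ℝ, F) f w) U := by
  intro y hy
  obtain ⟨V, hVy, hV, hVU, hc, ht, he⟩ := pull_eventuallyEq hU hf w hy
  refine ContDiffAt.contDiffWithinAt ?_
  refine ContDiffOn.contDiffAt (s := V) ?_ hVy
  refine ContDiffOn.congr ?_ he
  have h1 : ContDiffOn ℝ ∞ (fun z => inChart I (f y) w (extChartAt I (f y) (f z))) V :=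
    (hw (f y)).comp hc ht
  have h2 : ContDiffOn ℝ ∞ (fderiv ℝ (extChartAt I (f y) ∘ f)) V :=
    hc.fderiv_of_isOpen hV (by simp)
  exact contDiff_comp.comp_contDiffOn (h1.prodMk h2)

lemma extDeriv_pull {f : F → M} {U : Set F} (hU : IsOpen U)
    (hf : ContMDiffOn 𝓘(ℝ, F) I ∞ f U) {w : M → E [⋀^Fin k]→L[ℝ] ℝ} (hw : w ∈ smoothForms I M k)
    {y : F} (hy : y ∈ U) :
    extDeriv (pull I 𝓘(ℝ, F) f w) y = pull I 𝓘(ℝ, F) f (rawD I w) y := by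
  obtain ⟨V, hVy, hV, hVU, hc, ht, he⟩ := pull_eventuallyEq hU hf w hy
  have hyV := mem_of_mem_nhds hVy
  have h1 : pull I 𝓘(ℝ, F) f w =ᶠ[𝓝 y] fun z =>
      (inChart I (f y) w ((extChartAt I (f y) ∘ f) z)).compContinuousLinearMap
          (fderiv ℝ (extChartAt I (f y) ∘ f) z) := by
    filter_upwards [hVy] with z hz using he z hz
  have hd : DifferentiableAt ℝ (inChart I (f y) w) ((extChartAt I (f y) ∘ f) y) :=
    ((hw (f y)).contDiffAt ((isOpen_extChartAt_target (f y)).mem_nhds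
      (ht y hyV))).differentiableAt (by simp)
  rw [h1.extDeriv_eq, extDeriv_pullback (r := ∞) hd (hc.contDiffAt hVy) two_le_infty]
  have h3 : fderiv ℝ (extChartAt I (f y) ∘ f) y = (mfderiv I 𝓘(ℝ, E) (extChartAt I (f y)) (f y)) ∘L
      (mfderiv 𝓘(ℝ, F) I f y) := by
    rw [← mfderiv_eq_fderiv, mfderiv_comp (I' := I)]
    · exact mdifferentiableAt_extChartAt (I := I) (mem_chart_source H (f y))
    · exact ((hf y hy).contMDiffAt (hU.mem_nhds hy)).mdifferentiableAt (by simp)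
  rw [h3]
  rfl

lemma contMDiffOn_chart_symm (x₀ : M) :
    ContMDiffOn 𝓘(ℝ, E) I ∞ (extChartAt I x₀).symm (extChartAt I x₀).target :=
  contMDiffOn_extChartAt_symm x₀

lemma inChart_rawD {w : M → E [⋀^Fin k]→L[ℝ] ℝ} (hw : w ∈ smoothForms I M k) (x₀ : M)
    {y : E} (hy : y ∈ (extChartAt I x₀).target) :
    inChart I x₀ (rawD I w) y = extDeriv (inChart I x₀ w) y :=
  (extDeriv_pull (isOpen_extChartAt_target x₀) (contMDiffOn_chart_symm x₀) hw hy).symm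

lemma rawD_mem {w : M → E [⋀^Fin k]→L[ℝ] ℝ} (hw : w ∈ smoothForms I M k) :
    rawD I w ∈ smoothForms I M (k + 1) := by
  intro x₀
  refine ContDiffOn.congr ?_ (fun y hy => inChart_rawD hw x₀ hy)
  exact (alternatizeUncurryFinCLM ℝ E ℝ).contDiff.comp_contDiffOn
    ((hw x₀).fderiv_of_isOpen (isOpen_extChartAt_target x₀) (m := ∞) (by simp))

lemma Form.diffAt (w : Form I M k) (x₀ : M) {y : E} (hy : y ∈ (extChartAt I x₀).target) :
    DifferentiableAt ℝ (inChart I x₀ w.1) y :=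
  ((w.2 x₀).contDiffAt ((isOpen_extChartAt_target x₀).mem_nhds hy)).differentiableAt (by simp)

/-- Two forms agreeing in the chart at every point are equal. -/
lemma eq_of_inChart {w w' : M → E [⋀^Fin k]→L[ℝ] ℝ}
    (h : ∀ x, inChart I x w (extChartAt I x x) = inChart I x w' (extChartAt I x x)) : w = w' := by
  have key : ∀ (w : M → E [⋀^Fin k]→L[ℝ] ℝ) (x : M), w x =
      (inChart I x w (extChartAt I x x)).compContinuousLinearMap
        (mfderiv I 𝓘(ℝ, E) (extChartAt I x) x) := by
    intro w x
    have h1 : (id : M → M) =ᶠ[𝓝 x] (extChartAt I x).symm ∘ extChartAt I x := by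
      filter_upwards [extChartAt_source_mem_nhds (I := I) x] with z hz
      exact ((extChartAt I x).left_inv hz).symm
    have h2 : pull I I id w x = w x := by
      simp only [pull, mfderiv_id]
      rfl
    rw [← h2, pull_congr w h1, pull_comp (I' := 𝓘(ℝ, E)) w]
    · rfl
    · exact ((contMDiffOn_chart_symm x).contMDiffAt
        (extChartAt_target_mem_nhds x)).mdifferentiableAt (by simp)
    · exact mdifferentiableAt_extChartAt (mem_chart_source H x)
  funext x
  rw [key w, key w', h]

variable (I) in
/-- The exterior derivative `d : Ω^k(M) → Ω^{k+1}(M)`. -/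
def extD : Form I M k →ₗ[ℝ] Form I M (k + 1) where
  toFun w := ⟨rawD I w.1, rawD_mem w.2⟩
  map_add' w w' := by
    ext1
    funext x
    have h := mem_extChartAt_target (I := I) x
    change rawD I (w.1 + w'.1) x = rawD I w.1 x + rawD I w'.1 x
    simp only [rawD]
    rw [inChart_add, extDeriv_add (w.diffAt x h) (w'.diffAt x h)]
    rfl
  map_smul' c w := by
    ext1
    funext x
    change rawD I (c • w.1) x = c • rawD I w.1 x
    simp only [rawD]
    rw [inChart_smul, extDeriv_smul]
    rfl

lemma inChart_extD (w : Form I M k) (x₀ : M) {y : E} (hy : y ∈ (extChartAt I x₀).target) :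
    inChart I x₀ (extD I w).1 y = extDeriv (inChart I x₀ w.1) y := inChart_rawD w.2 x₀ hy

/-- The wedge product `θ ∧ β` of a one-form with a `k`-form, as a bilinear map. -/
def wedgeForm : Form I M 1 →ₗ[ℝ] Form I M k →ₗ[ℝ] Form I M (k + 1) :=
  LinearMap.mk₂ ℝ (fun θ β => ⟨fun x => wedge (θ.1 x) (β.1 x), by
    intro x₀
    have h : inChart I x₀ (fun x => wedge (θ.1 x) (β.1 x)) =
        fun y => wedgeL E k (inChart I x₀ θ.1 y) (inChart I x₀ β.1 y) := by
      funext y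
      exact wedge_comp _ _ _
    rw [h]
    exact ((wedgeL E k).contDiff.comp_contDiffOn (θ.2 x₀)).clm_apply (β.2 x₀)⟩)
    (by intro a b c; ext1; funext x; change wedgeL E k _ _ = wedgeL E k _ _ + wedgeL E k _ _
        simp)
    (by intro c a b; ext1; funext x; change wedgeL E k _ _ = c • wedgeL E k _ _; simp)
    (by intro a b c; ext1; funext x; change wedgeL E k _ _ = wedgeL E k _ _ + wedgeL E k _ _
        simp)
    (by intro c a b; ext1; funext x; change wedgeL E k _ _ = c • wedgeL E k _ _; simp)

lemma wedgeForm_apply (θ : Form I M 1) (β : Form I M k) (x : M) :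
    (wedgeForm θ β).1 x = wedge (θ.1 x) (β.1 x) := rfl

lemma inChart_wedge (θ : Form I M 1) (β : Form I M k) (x₀ : M) (y : E) :
    inChart I x₀ (wedgeForm θ β).1 y = wedge (inChart I x₀ θ.1 y) (inChart I x₀ β.1 y) :=
  wedge_comp _ _ _

/-- The product `g • β` of a function (a zero-form) with a `k`-form. -/
def mulForm (g : Form I M 0) (β : Form I M k) : Form I M k :=
  ⟨fun x => zval E (g.1 x) • β.1 x, by
    intro x₀
    have h : inChart I x₀ (fun x => zval E (g.1 x) • β.1 x) =
        fun y => zval E (inChart I x₀ g.1 y) • (inChart I x₀ β.1 y) := by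
      funext y
      exact zsmul_comp _ _ _
    rw [h]
    exact ((zval E).contDiff.comp_contDiffOn (g.2 x₀)).smul (β.2 x₀)⟩

lemma inChart_mul (g : Form I M 0) (β : Form I M k) (x₀ : M) (y : E) :
    inChart I x₀ (mulForm g β).1 y = zval E (inChart I x₀ g.1 y) • inChart I x₀ β.1 y :=
  zsmul_comp _ _ _

lemma extD_wedge_of_closed (θ : Form I M 1) (β : Form I M k) (h : extD I θ = 0) :
    extD I (wedgeForm θ β) = - wedgeForm θ (extD I β) := by
  ext1
  refine eq_of_inChart (I := I) fun x => ?_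
  have hx := mem_extChartAt_target (I := I) x
  rw [inChart_extD _ _ hx]
  have h1 : inChart I x (wedgeForm θ β).1 =
      fun y => wedge (inChart I x θ.1 y) (inChart I x β.1 y) := funext (inChart_wedge θ β x)
  have h2 : inChart I x (-wedgeForm θ (extD I β)).1 (extChartAt I x x) =
      -inChart I x (wedgeForm θ (extD I β)).1 (extChartAt I x x) := rfl
  rw [h1, h2, inChart_wedge, inChart_extD _ _ hx]
  refine extDeriv_wedge (θ.diffAt x hx) (β.diffAt x hx) ?_
  rw [← inChart_extD _ _ hx, h]
  rfl

lemma extD_mul (g : Form I M 0) (β : Form I M k) :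
    extD I (mulForm g β) = wedgeForm (extD I g) β + mulForm g (extD I β) := by
  ext1
  refine eq_of_inChart (I := I) fun x => ?_
  have hx := mem_extChartAt_target (I := I) x
  rw [inChart_extD _ _ hx]
  have h0 : inChart I x (mulForm g β).1 =
      fun y => zval E (inChart I x g.1 y) • inChart I x β.1 y := funext (inChart_mul g β x)
  have h1 : inChart I x (wedgeForm (extD I g) β + mulForm g (extD I β)).1 (extChartAt I x x) =
      inChart I x (wedgeForm (extD I g) β).1 (extChartAt I x x) +
        inChart I x (mulForm g (extD I β)).1 (extChartAt I x x) := rfl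
  rw [h1, h0, inChart_wedge, inChart_mul, inChart_extD _ _ hx, inChart_extD _ _ hx]
  exact extDeriv_zsmul (g.diffAt x hx) (β.diffAt x hx)

lemma wedge_mul (g : Form I M 0) (θ : Form I M 1) (β : Form I M k) :
    wedgeForm θ (mulForm g β) = mulForm g (wedgeForm θ β) := by
  ext1
  funext x
  change wedgeL E k _ (_ • _) = _ • wedgeL E k _ _
  simp

lemma wedgeForm_wedge (θ η : Form I M 1) (β : Form I M k) :
    wedgeForm θ (wedgeForm η β) = - wedgeForm η (wedgeForm θ β) := by
  ext1
  funext x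
  exact wedge_wedge _ _ _

lemma extD_extD (w : Form I M k) : extD I (extD I w) = 0 := by
  ext1
  refine eq_of_inChart (I := I) fun x => ?_
  have hx := mem_extChartAt_target (I := I) x
  have ho := isOpen_extChartAt_target (I := I) x
  rw [inChart_extD _ _ hx]
  have h : inChart I x (extD I w).1 =ᶠ[𝓝 (extChartAt I x x)] extDeriv (inChart I x w.1) := by
    filter_upwards [ho.mem_nhds hx] with y hy using inChart_extD w x hy
  rw [h.extDeriv_eq, extDeriv_extDeriv_apply ((w.2 x).contDiffAt (ho.mem_nhds hx)) two_le_infty]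
  rfl

variable [IsManifold I' ∞ M'] [I'.Boundaryless] [IsManifold I'' ∞ M''] [I''.Boundaryless]

lemma inChart_pull {f : M' → M} (hf : ContMDiff I' I ∞ f) (w : M → E [⋀^Fin k]→L[ℝ] ℝ) (x₀ : M')
    {y : E'} (hy : y ∈ (extChartAt I' x₀).target) :
    inChart I' x₀ (pull I I' f w) y = pull I 𝓘(ℝ, E') (f ∘ (extChartAt I' x₀).symm) w y := by
  rw [pull_comp (I' := I') w (hf.mdifferentiableAt (by simp))]
  · rfl
  · exact ((contMDiffOn_chart_symm x₀).contMDiffAt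
      ((isOpen_extChartAt_target x₀).mem_nhds hy)).mdifferentiableAt (by simp)

lemma contMDiffOn_comp_chart_symm {f : M' → M} (hf : ContMDiff I' I ∞ f) (x₀ : M') :
    ContMDiffOn 𝓘(ℝ, E') I ∞ (f ∘ (extChartAt I' x₀).symm) (extChartAt I' x₀).target :=
  hf.comp_contMDiffOn (contMDiffOn_chart_symm x₀)

lemma pull_mem {f : M' → M} (hf : ContMDiff I' I ∞ f) {w : M → E [⋀^Fin k]→L[ℝ] ℝ}
    (hw : w ∈ smoothForms I M k) : pull I I' f w ∈ smoothForms I' M' k := fun x₀ =>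
  (contDiffOn_pull (isOpen_extChartAt_target x₀) (contMDiffOn_comp_chart_symm hf x₀) hw).congr
    fun _ hy => inChart_pull hf w x₀ hy

/-- The pullback `f^* : Ω^k(M) → Ω^k(M')` of forms along a smooth map `f : M' → M`. -/
def pullForm (f : M' → M) (hf : ContMDiff I' I ∞ f) : Form I M k →ₗ[ℝ] Form I' M' k where
  toFun w := ⟨pull I I' f w.1, pull_mem hf w.2⟩
  map_add' _ _ := rfl
  map_smul' _ _ := rfl

lemma pullForm_extD {f : M' → M} (hf : ContMDiff I' I ∞ f) (w : Form I M k) :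
    extD I' (pullForm f hf w) = pullForm f hf (extD I w) := by
  ext1
  refine eq_of_inChart (I := I') fun x => ?_
  have hx := mem_extChartAt_target (I := I') x
  have ho := isOpen_extChartAt_target (I := I') x
  have h : inChart I' x (pullForm f hf w).1 =ᶠ[𝓝 (extChartAt I' x x)]
      pull I 𝓘(ℝ, E') (f ∘ (extChartAt I' x).symm) w.1 := by
    filter_upwards [ho.mem_nhds hx] with y hy using inChart_pull hf w.1 x hy
  rw [inChart_extD _ _ hx, h.extDeriv_eq,
    extDeriv_pull ho (contMDiffOn_comp_chart_symm hf x) w.2 hx]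
  exact (inChart_pull hf _ x hx).symm

lemma pullForm_wedge {f : M' → M} (hf : ContMDiff I' I ∞ f) (θ : Form I M 1) (β : Form I M k) :
    pullForm f hf (wedgeForm θ β) = wedgeForm (pullForm f hf θ) (pullForm f hf β) := by
  ext1
  funext x
  exact wedge_comp _ _ _

/-- A smooth function as a zero-form. -/
def ofFun (f : M → ℝ) (hf : ContMDiff I 𝓘(ℝ, ℝ) ∞ f) : Form I M 0 :=
  ⟨fun x => constOfIsEmpty ℝ E (Fin 0) (f x), fun x₀ => by
    have h : inChart I x₀ (fun x => constOfIsEmpty ℝ E (Fin 0) (f x)) =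
        fun y => constOfIsEmptyLIE ℝ E ℝ (Fin 0) (f ((extChartAt I x₀).symm y)) := rfl
    rw [h]
    exact (constOfIsEmptyLIE ℝ E ℝ (Fin 0)).toContinuousLinearEquiv.contDiff.comp_contDiffOn
      (contMDiffOn_iff_contDiffOn.1 (hf.comp_contMDiffOn (contMDiffOn_chart_symm x₀)))⟩

lemma zval_ofFun (f : M → ℝ) (hf : ContMDiff I 𝓘(ℝ, ℝ) ∞ f) (x : M) :
    zval E ((ofFun f hf).1 x) = f x := rfl

/-- The exterior derivative of a function is its differential. -/
lemma extD_ofFun (f : M → ℝ) (hf : ContMDiff I 𝓘(ℝ, ℝ) ∞ f) (x : M) :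
    (extD I (ofFun f hf)).1 x =
      ofSubsingleton ℝ E ℝ (0 : Fin 1) (mfderiv I 𝓘(ℝ, ℝ) f x : E →L[ℝ] ℝ) := by
  have hx := mem_extChartAt_target (I := I) x
  have h1 : (id : M → M) =ᶠ[𝓝 x] (extChartAt I x).symm ∘ extChartAt I x := by
    filter_upwards [extChartAt_source_mem_nhds (I := I) x] with z hz
    exact ((extChartAt I x).left_inv hz).symm
  have h2 : f =ᶠ[𝓝 x] (f ∘ (extChartAt I x).symm) ∘ extChartAt I x := by
    filter_upwards [h1] with z hz
    exact congrArg f hz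
  have h3 : mfderiv I 𝓘(ℝ, ℝ) f x = (fderiv ℝ (f ∘ (extChartAt I x).symm) (extChartAt I x x)) ∘L
      (mfderiv I 𝓘(ℝ, E) (extChartAt I x) x) := by
    rw [h2.mfderiv_eq, mfderiv_comp (I' := 𝓘(ℝ, E)), mfderiv_eq_fderiv]
    · rfl
    · exact ((hf.comp_contMDiffOn (contMDiffOn_chart_symm x)).contMDiffAt
        (extChartAt_target_mem_nhds x)).mdifferentiableAt (by simp)
    · exact mdifferentiableAt_extChartAt (mem_chart_source H x)
  have h4 : inChart I x (ofFun f hf).1 =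
      fun y => constOfIsEmpty ℝ E (Fin 0) ((f ∘ (extChartAt I x).symm) y) := rfl
  change rawD I (ofFun f hf).1 x = _
  rw [rawD, h4, extDeriv_constOfIsEmpty, h3]
  rfl

/-! ### Morse–Novikov cohomology -/

/-- The twisted differential `d_θ α = dα - θ ∧ α`. -/
def mnD (θ : Form I M 1) (k : ℕ) : Form I M k →ₗ[ℝ] Form I M (k + 1) :=
  extD I - wedgeForm θ

lemma mnD_apply (θ : Form I M 1) (β : Form I M k) : mnD θ k β = extD I β - wedgeForm θ β := rfl

lemma mnD_zero (β : Form I M k) : mnD 0 k β = extD I β := by simp [mnD_apply]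

/-- The `k`-cocycles of `d_θ`. -/
def cocycles (θ : Form I M 1) (k : ℕ) : Submodule ℝ (Form I M k) := LinearMap.ker (mnD θ k)

/-- The `k`-coboundaries of `d_θ`. -/
def coboundaries (θ : Form I M 1) : (k : ℕ) → Submodule ℝ (Form I M k)
  | 0 => ⊥
  | k + 1 => LinearMap.range (mnD θ k)

/-- `d_θ ∘ d_θ = 0` when `θ` is closed. -/
lemma coboundaries_le_cocycles (θ : Form I M 1) (hθ : extD I θ = 0) (k : ℕ) :
    coboundaries θ k ≤ cocycles θ k := by
  cases k with
  | zero => exact bot_le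
  | succ k =>
    rintro _ ⟨β, rfl⟩
    have hw : wedgeForm θ (wedgeForm θ β) = 0 := by
      have h2 : (2 : ℝ) • wedgeForm θ (wedgeForm θ β) = 0 := by
        rw [two_smul]
        nth_rewrite 1 [wedgeForm_wedge θ θ β]
        exact neg_add_cancel _
      exact (smul_eq_zero.1 h2).resolve_left two_ne_zero
    change mnD θ (k + 1) (mnD θ k β) = 0
    simp [mnD_apply, extD_extD, extD_wedge_of_closed θ β hθ, hw]

/-- The Morse–Novikov cohomology `H^k_θ(M)` of a closed one-form `θ`. -/
abbrev MNCohomology (θ : Form I M 1) (k : ℕ) : Type _ :=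
  cocycles θ k ⧸ (coboundaries θ k).comap (cocycles θ k).subtype

/-- The class `[β] ∈ H^k_θ(M)` of a `d_θ`-closed form `β`. -/
def mnClass (θ : Form I M 1) (k : ℕ) : cocycles θ k →ₗ[ℝ] MNCohomology θ k :=
  Submodule.mkQ _

variable (I) in
/-- The de Rham cohomology `H^k(M)`, that is, the cohomology of `d = d_0`. -/
abbrev DeRham (M : Type*) [TopologicalSpace M] [ChartedSpace H M] [IsManifold I ∞ M]
    (k : ℕ) : Type _ := MNCohomology (0 : Form I M 1) k

/-! ### Lie affine foliations -/

/-- The covector `w_x : T_x M → ℝ` of a one-form `w` at `x`. -/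
def Form.covector (w : Form I M 1) (x : M) : TangentSpace I x →L[ℝ] ℝ :=
  ((ofSubsingletonLIE (𝕜 := ℝ) (E := E) (F := ℝ) (0 : Fin 1)).symm (w.1 x) : E →L[ℝ] ℝ)

variable (I) in
/-- The defining data of a Lie `𝔞𝔣𝔣(1)`-foliation: a pair of one-forms that are linearly independent
at every point and satisfy `dω₁ - ω₂ ∧ ω₁ = 0` and `dω₂ = 0`. -/
structure LieAffinePair (M : Type*) [TopologicalSpace M] [ChartedSpace H M]
    [IsManifold I ∞ M] where
  /-- the first form -/
  ω₁ : Form I M 1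
  /-- the second form -/
  ω₂ : Form I M 1
  eq₁ : extD I ω₁ - wedgeForm ω₂ ω₁ = 0
  eq₂ : extD I ω₂ = 0
  indep : ∀ x, LinearIndependent ℝ ![ω₁.covector x, ω₂.covector x]

namespace LieAffinePair

variable (P : LieAffinePair I M)

/-- The tangent distribution `ker ω₁ ∩ ker ω₂` of the foliation defined by `(ω₁, ω₂)`. A foliation
is determined by its tangent distribution. -/
def tangentDistribution (x : M) : Submodule ℝ (TangentSpace I x) :=
  (P.ω₁.covector x).ker ⊓ (P.ω₂.covector x).ker

/-- The class `[ω₁] ∈ H^1_{ω₂}(M)`. -/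
def class₁ : MNCohomology P.ω₂ 1 := mnClass P.ω₂ 1 ⟨P.ω₁, P.eq₁⟩

lemma wedge_mem (γ : Form I M 1) (hγ : γ ∈ cocycles (0 : Form I M 1) 1) :
    wedgeForm γ P.ω₁ ∈ cocycles P.ω₂ 2 := by
  have h0 : extD I γ = 0 := by rw [← mnD_zero]; exact hγ
  have h1 : extD I P.ω₁ = wedgeForm P.ω₂ P.ω₁ := sub_eq_zero.1 P.eq₁
  change mnD P.ω₂ 2 _ = 0
  rw [mnD_apply, extD_wedge_of_closed γ _ h0, h1, wedgeForm_wedge P.ω₂ γ, sub_self]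

lemma wedge_exact_mem (g : Form I M 0) :
    wedgeForm (extD I g) P.ω₁ ∈ coboundaries P.ω₂ 2 := by
  refine ⟨mulForm g P.ω₁, ?_⟩
  have h1 : extD I P.ω₁ = wedgeForm P.ω₂ P.ω₁ := sub_eq_zero.1 P.eq₁
  rw [mnD_apply, extD_mul, h1, wedge_mul, add_sub_cancel_right]

/-- The map `• ∧ [ω₁] : H^1(M) → H^2_{ω₂}(M)`, `[γ] ↦ [γ ∧ ω₁]`. -/
def wedgeClass : DeRham I M 1 →ₗ[ℝ] MNCohomology P.ω₂ 2 :=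
  Submodule.mapQ _ _
    (LinearMap.restrict (wedgeForm.flip P.ω₁) (p := cocycles (0 : Form I M 1) 1)
      (q := cocycles P.ω₂ 2) P.wedge_mem) (by
    rintro ⟨_, hγ⟩ ⟨g, rfl⟩
    have h := P.wedge_exact_mem g
    rw [← mnD_zero] at h
    exact h)

lemma wedgeClass_mnClass (γ : cocycles (0 : Form I M 1) 1) :
    P.wedgeClass (mnClass 0 1 γ) =
      mnClass P.ω₂ 2 ⟨wedgeForm γ.1 P.ω₁, P.wedge_mem γ.1 γ.2⟩ := rfl

/-- The cohomological conditions: `H^1_{ω₂}(M) = ℝ[ω₁]`, and `• ∧ [ω₁] : H^1(M) → H^2_{ω₂}(M)` is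
injective. -/
def CohomologicalConditions : Prop :=
  (⊤ : Submodule ℝ (MNCohomology P.ω₂ 1)) = Submodule.span ℝ {P.class₁} ∧
    Function.Injective P.wedgeClass

end LieAffinePair

end Forms

/-! ### Quotients by smooth deck transformations -/

section Quotients

variable {E : Type*} [NormedAddCommGroup E] [NormedSpace ℝ E] {H : Type*} [TopologicalSpace H]
  {J : ModelWithCorners ℝ E H} [J.Boundaryless]
  {X : Type*} [TopologicalSpace X] [ChartedSpace H X] [IsManifold J ∞ X]
  {Y : Type*} [TopologicalSpace Y] {q : X → Y} {k : ℕ}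

variable (J) in
/-- Points in the same fibre of `q` are related by a smooth map `X → X` over `Y`. -/
def HasDeck (q : X → Y) : Prop :=
  ∀ p p', q p = q p' → ∃ d : X → X, ContMDiff J J ∞ d ∧ d p = p' ∧ ∀ z, q (d z) = q z

lemma section_comp_eventuallyEq (hq : IsLocalHomeomorph q) (x₀ p : X)
    (hp : q p ∈ (hq.localInverseAt x₀).source) {d : X → X} (hd : Continuous d)
    (hdp : d p = hq.localInverseAt x₀ (q p)) (hdq : ∀ z, q (d z) = q z) :
    hq.localInverseAt x₀ ∘ q =ᶠ[𝓝 p] d := by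
  have h1 : d ⁻¹' (hq.localInverseAt x₀).target ∈ 𝓝 p := by
    refine hd.continuousAt.preimage_mem_nhds ((hq.localInverseAt x₀).open_target.mem_nhds ?_)
    rw [hdp]
    exact (hq.localInverseAt x₀).map_source hp
  filter_upwards [h1] with z hz
  have h2 := (hq.localInverseAt x₀).right_inv hz
  rw [hq.localInverseAt_symm, hdq] at h2
  exact h2

lemma HasDeck.section_comp (hdeck : HasDeck J q) (hq : IsLocalHomeomorph q) (x₀ p : X)
    (hp : q p ∈ (hq.localInverseAt x₀).source) :
    ∃ d : X → X, ContMDiff J J ∞ d ∧ d p = hq.localInverseAt x₀ (q p) ∧ (∀ z, q (d z) = q z) ∧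
      hq.localInverseAt x₀ ∘ q =ᶠ[𝓝 p] d := by
  obtain ⟨d, hd, hdp, hdq⟩ := hdeck p (hq.localInverseAt x₀ (q p))
    (hq.apply_localInverseAt_of_mem hp).symm
  exact ⟨d, hd, hdp, hdq, section_comp_eventuallyEq hq x₀ p hp hd.continuous hdp hdq⟩

lemma HasDeck.contMDiffAt_section_comp (hdeck : HasDeck J q) (hq : IsLocalHomeomorph q) (x₀ p : X)
    (hp : q p ∈ (hq.localInverseAt x₀).source) :
    ContMDiffAt J J ∞ (hq.localInverseAt x₀ ∘ q) p := by
  obtain ⟨d, hd, -, -, he⟩ := hdeck.section_comp hq x₀ p hp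
  exact hd.contMDiffAt.congr_of_eventuallyEq he

lemma HasDeck.isManifold (hdeck : HasDeck J q) (hq : IsLocalHomeomorph q)
    (hs : Function.Surjective q) :
    letI := hq.chartedSpace (H := H) hs
    IsManifold J ∞ Y := by
  letI := hq.chartedSpace (H := H) hs
  refine isManifold_of_contDiffOn J ∞ Y ?_
  rintro e e' ⟨y, rfl⟩ ⟨y', rfl⟩
  set x := hs.hasRightInverse.choose y
  set x' := hs.hasRightInverse.choose y'
  intro z hz
  refine ContDiffAt.contDiffWithinAt ?_
  rw [← contMDiffAt_iff_contDiffAt]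
  simp only [OpenPartialHomeomorph.trans_source, OpenPartialHomeomorph.symm_source,
    OpenPartialHomeomorph.trans_target, OpenPartialHomeomorph.coe_trans,
    OpenPartialHomeomorph.coe_trans_symm, Set.mem_inter_iff, Set.mem_preimage,
    Function.comp_apply, IsLocalHomeomorph.localInverseAt_symm] at hz
  obtain ⟨⟨⟨hz1, hz2⟩, hz3, hz4⟩, -⟩ := hz
  have hzt : z ∈ (extChartAt J x).target := by
    rw [extChartAt_target, J.range_eq_univ, Set.inter_univ]
    exact hz1
  have h1 : ContMDiffAt 𝓘(ℝ, E) J ∞ (extChartAt J x).symm z :=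
    (contMDiffOn_chart_symm x).contMDiffAt ((isOpen_extChartAt_target x).mem_nhds hzt)
  have h2 : ContMDiffAt J J ∞ (hq.localInverseAt x' ∘ q) ((extChartAt J x).symm z) :=
    hdeck.contMDiffAt_section_comp hq x' _ hz3
  have h3 : ContMDiffAt J 𝓘(ℝ, E) ∞ (extChartAt J x')
      ((hq.localInverseAt x' ∘ q) ((extChartAt J x).symm z)) :=
    contMDiffAt_extChartAt' hz4
  have h := h3.comp z (h2.comp z h1)
  convert h using 1
  funext u
  simp

variable [ChartedSpace H Y] [IsManifold J ∞ Y]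

/-- The charts of `Y` are obtained from those of `X` by composing with local inverses of `q`. -/
def IsQuotientAtlas (hq : IsLocalHomeomorph q) (g : Y → X) : Prop :=
  (∀ y, q (g y) = y) ∧ ∀ y, chartAt H y = (hq.localInverseAt (g y)).trans (chartAt H (g y))

variable {hq : IsLocalHomeomorph q} {g : Y → X}

set_option linter.unusedSectionVars false

lemma mem_section_source (hg : IsQuotientAtlas (H := H) hq g) (y : Y) :
    y ∈ (hq.localInverseAt (g y)).source := by
  have := hq.apply_self_mem_localInverseAt_source (x := g y)
  rwa [hg.1 y] at this

lemma extChartAt_quotient (hg : IsQuotientAtlas (H := H) hq g) (y : Y) :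
    (extChartAt J y : Y → E) = extChartAt J (g y) ∘ hq.localInverseAt (g y) := by
  funext u
  simp [extChartAt, hg.2 y]

lemma extChartAt_quotient_symm (hg : IsQuotientAtlas (H := H) hq g) (y : Y) :
    ((extChartAt J y).symm : E → Y) = q ∘ (extChartAt J (g y)).symm := by
  funext u
  simp [extChartAt, hg.2 y]

lemma extChartAt_quotient_target (hg : IsQuotientAtlas (H := H) hq g) (y : Y) :
    (extChartAt J y).target ⊆ (extChartAt J (g y)).target := by
  intro u hu
  rw [extChartAt_target] at hu ⊢
  rw [hg.2 y] at hu
  exact ⟨hu.1.1, hu.2⟩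

lemma contMDiff_quotient (hdeck : HasDeck J q) (hg : IsQuotientAtlas (H := H) hq g) :
    ContMDiff J J ∞ q := by
  intro p
  rw [contMDiffAt_iff_target]
  refine ⟨hq.continuous.continuousAt, ?_⟩
  rw [extChartAt_quotient hg, Function.comp_assoc]
  have hm := mem_section_source hg (q p)
  refine ContMDiffAt.comp p ?_ (hdeck.contMDiffAt_section_comp hq _ p hm)
  have : (hq.localInverseAt (g (q p)) ∘ q) p = g (q p) := by
    have := hq.localInverseAt_apply_self (x := g (q p))
    rwa [hg.1 (q p)] at this
  rw [this]
  exact contMDiffAt_extChartAt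

lemma contMDiffAt_section (hdeck : HasDeck J q) (hg : IsQuotientAtlas (H := H) hq g) (y : Y) :
    ContMDiffAt J J ∞ (hq.localInverseAt (g y)) y := by
  rw [contMDiffAt_iff_source, extChartAt_quotient_symm hg]
  refine ContMDiffAt.contMDiffWithinAt ?_
  have hy : extChartAt J y y = extChartAt J (g y) (g y) := by
    rw [extChartAt_quotient hg, Function.comp_apply]
    have := hq.localInverseAt_apply_self (x := g y)
    rw [hg.1 y] at this
    rw [this]
  have h1 : ContMDiffAt 𝓘(ℝ, E) J ∞ (extChartAt J (g y)).symm (extChartAt J y y) := by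
    rw [hy]
    exact (contMDiffOn_chart_symm (g y)).contMDiffAt (extChartAt_target_mem_nhds (g y))
  have h2 : ContMDiffAt J J ∞ (hq.localInverseAt (g y) ∘ q)
      ((extChartAt J (g y)).symm (extChartAt J y y)) := by
    apply hdeck.contMDiffAt_section_comp hq
    rw [hy, extChartAt_to_inv, hg.1 y]
    exact mem_section_source hg y
  exact h2.comp _ h1

lemma pull_section (hdeck : HasDeck J q) (hg : IsQuotientAtlas (H := H) hq g)
    (w : Y → E [⋀^Fin k]→L[ℝ] ℝ) (y : Y) :
    pull J J (hq.localInverseAt (g y)) (pull J J q w) y = w y := by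
  have h1 : (id : Y → Y) =ᶠ[𝓝 y] q ∘ hq.localInverseAt (g y) := by
    filter_upwards [(hq.localInverseAt (g y)).open_source.mem_nhds (mem_section_source hg y)]
      with u hu
    exact (hq.apply_localInverseAt_of_mem hu).symm
  rw [← pull_comp (I' := J) w ((contMDiff_quotient hdeck hg).mdifferentiableAt (by simp))
    ((contMDiffAt_section hdeck hg y).mdifferentiableAt (by simp)), ← pull_congr w h1]
  simp only [pull, mfderiv_id]
  rfl

/-- The form on `Y` obtained by pulling a form on `X` back along local inverses of `q`. -/
def descend (hq : IsLocalHomeomorph q) (g : Y → X) (w : X → E [⋀^Fin k]→L[ℝ] ℝ) :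
    Y → E [⋀^Fin k]→L[ℝ] ℝ :=
  fun y => pull J J (hq.localInverseAt (g y)) w y

lemma pull_descend (hdeck : HasDeck J q) (hg : IsQuotientAtlas (H := H) hq g)
    {w : X → E [⋀^Fin k]→L[ℝ] ℝ}
    (hw : ∀ d : X → X, ContMDiff J J ∞ d → (∀ z, q (d z) = q z) → pull J J d w = w) :
    pull J J q (descend (J := J) hq g w) = w := by
  funext p
  have hm := mem_section_source hg (q p)
  obtain ⟨d, hd, -, hdq, he⟩ := hdeck.section_comp hq (g (q p)) p hm
  have h1 : pull J J q (descend (J := J) hq g w) p =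
      pull J J q (pull J J (hq.localInverseAt (g (q p))) w) p := rfl
  rw [h1, ← pull_comp (I' := J) w
    ((contMDiffAt_section hdeck hg (q p)).mdifferentiableAt (by simp))
    ((contMDiff_quotient hdeck hg).mdifferentiableAt (by simp)), pull_congr w he, hw d hd hdq]

lemma descend_mem (hdeck : HasDeck J q) (hg : IsQuotientAtlas (H := H) hq g)
    {w : X → E [⋀^Fin k]→L[ℝ] ℝ} (hs : w ∈ smoothForms J X k)
    (hw : ∀ d : X → X, ContMDiff J J ∞ d → (∀ z, q (d z) = q z) → pull J J d w = w) :
    descend (J := J) hq g w ∈ smoothForms J Y k := by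
  intro y₀
  refine ((hs (g y₀)).mono (extChartAt_quotient_target hg y₀)).congr fun u hu => ?_
  have hu' := extChartAt_quotient_target hg y₀ hu
  rw [inChart, extChartAt_quotient_symm hg, pull_comp (I' := J), pull_descend hdeck hg hw]
  · rfl
  · exact (contMDiff_quotient hdeck hg).mdifferentiableAt (by simp)
  · exact ((contMDiffOn_chart_symm (g y₀)).contMDiffAt
      ((isOpen_extChartAt_target (g y₀)).mem_nhds hu')).mdifferentiableAt (by simp)

end Quotients

/-! ### Mapping tori -/

section MappingTorus

variable {E : Type*} [NormedAddCommGroup E] [NormedSpace ℝ E] {H : Type*} [TopologicalSpace H]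
  {I : ModelWithCorners ℝ E H} {L : Type*} [TopologicalSpace L] [ChartedSpace H L]

/-- The product `L × ℝ`, equipped with the `ℤ`-action generated by `(x, t) ↦ (φ x, t + 1)`. -/
def Cover (_φ : L ≃ₘ⟮I, I⟯ L) : Type _ := L × ℝ

namespace Cover

variable (φ : L ≃ₘ⟮I, I⟯ L)

instance : TopologicalSpace (Cover φ) := inferInstanceAs (TopologicalSpace (L × ℝ))
instance : ChartedSpace (ModelProd H ℝ) (Cover φ) :=
  inferInstanceAs (ChartedSpace (ModelProd H ℝ) (L × ℝ))
instance [IsManifold I ∞ L] : IsManifold (I.prod 𝓘(ℝ, ℝ)) ∞ (Cover φ) :=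
  inferInstanceAs (IsManifold (I.prod 𝓘(ℝ, ℝ)) ∞ (L × ℝ))
instance [T2Space L] : T2Space (Cover φ) := inferInstanceAs (T2Space (L × ℝ))
instance [T2Space L] [CompactSpace L] : LocallyCompactSpace (Cover φ) :=
  inferInstanceAs (LocallyCompactSpace (L × ℝ))

instance : AddAction ℤ (Cover φ) where
  vadd n p := ((φ.toEquiv ^ n : Equiv.Perm L) p.1, p.2 + n)
  zero_vadd p := by
    change ((φ.toEquiv ^ (0 : ℤ) : Equiv.Perm L) p.1, p.2 + ((0 : ℤ) : ℝ)) = p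
    simp
    rfl
  add_vadd m n p := by
    change ((φ.toEquiv ^ (m + n) : Equiv.Perm L) p.1, p.2 + ((m + n : ℤ) : ℝ)) =
      ((φ.toEquiv ^ m : Equiv.Perm L) ((φ.toEquiv ^ n : Equiv.Perm L) p.1), p.2 + n + m)
    rw [zpow_add, Equiv.Perm.mul_apply]
    push_cast
    rw [add_assoc, add_comm (m : ℝ)]

lemma vadd_def (n : ℤ) (p : Cover φ) :
    n +ᵥ p = ((φ.toEquiv ^ n : Equiv.Perm L) p.1, p.2 + n) := rfl

lemma one_vadd (p : Cover φ) : (1 : ℤ) +ᵥ p = (φ p.1, p.2 + 1) := by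
  rw [vadd_def, zpow_one, Int.cast_one]
  rfl

lemma contMDiff_zpow (n : ℤ) : ContMDiff I I ∞ (φ.toEquiv ^ n : Equiv.Perm L) := by
  induction n with
  | zero => exact contMDiff_id
  | succ n ih =>
    rw [zpow_add_one]
    exact ih.comp φ.contMDiff
  | pred n ih =>
    rw [zpow_sub_one]
    exact ih.comp φ.symm.contMDiff

lemma contMDiff_vadd (n : ℤ) :
    ContMDiff (I.prod 𝓘(ℝ, ℝ)) (I.prod 𝓘(ℝ, ℝ)) ∞ (fun p : Cover φ => n +ᵥ p) := by
  have h1 : ContMDiff (I.prod 𝓘(ℝ, ℝ)) I ∞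
      (fun p : L × ℝ => (φ.toEquiv ^ n : Equiv.Perm L) p.1) :=
    (contMDiff_zpow φ n).comp contMDiff_fst
  have h2 : ContMDiff (I.prod 𝓘(ℝ, ℝ)) 𝓘(ℝ, ℝ) ∞ (fun p : L × ℝ => p.2 + (n : ℝ)) :=
    ((contDiff_id.add contDiff_const).contMDiff (f := fun t : ℝ => t + n)).comp contMDiff_snd
  exact h1.prodMk h2

instance : ContinuousConstVAdd ℤ (Cover φ) := ⟨fun n => (contMDiff_vadd φ n).continuous⟩

instance : IsCancelVAdd ℤ (Cover φ) where
  left_cancel' n p p' h := by simpa using congrArg (fun z => -n +ᵥ z) h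
  right_cancel' m n p h := by
    have h2 : p.2 + (m : ℝ) = p.2 + n := congrArg Prod.snd h
    exact_mod_cast add_left_cancel h2

instance : ProperlyDiscontinuousVAdd ℤ (Cover φ) where
  finite_disjoint_inter_image {K K'} hK hK' := by
    have hs : Continuous (fun p : Cover φ => p.2) := continuous_snd (X := L) (Y := ℝ)
    obtain ⟨a, ha⟩ := (hK.image hs).isBounded.exists_norm_le
    obtain ⟨b, hb⟩ := (hK'.image hs).isBounded.exists_norm_le
    refine (Set.finite_Icc (-⌈a + b⌉) ⌈a + b⌉).subset ?_
    rintro n ⟨_, ⟨p, hp, rfl⟩, hp'⟩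
    have h1 := ha _ ⟨p, hp, rfl⟩
    have h2 : ‖p.2 + (n : ℝ)‖ ≤ b := hb _ ⟨_, hp', rfl⟩
    rw [Real.norm_eq_abs, abs_le] at h1 h2
    have h3 := Int.le_ceil (a + b)
    constructor
    · have : -(⌈a + b⌉ : ℝ) ≤ n := by linarith
      exact_mod_cast this
    · have : (n : ℝ) ≤ ⌈a + b⌉ := by linarith
      exact_mod_cast this

end Cover

variable [T2Space L] [CompactSpace L] (φ : L ≃ₘ⟮I, I⟯ L)

/-- The mapping torus `𝕋_φ = (L × ℝ) / ((x, t) ∼ (φ x, t + 1))`. -/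
def MappingTorus {E : Type*} [NormedAddCommGroup E] [NormedSpace ℝ E] {H : Type*}
    [TopologicalSpace H] {I : ModelWithCorners ℝ E H} {L : Type*} [TopologicalSpace L]
    [ChartedSpace H L] (φ : L ≃ₘ⟮I, I⟯ L) : Type _ :=
  AddAction.orbitRel.Quotient ℤ (Cover φ)

namespace MappingTorus

instance : TopologicalSpace (MappingTorus φ) :=
  inferInstanceAs (TopologicalSpace (AddAction.orbitRel.Quotient ℤ (Cover φ)))

/-- The quotient map `L × ℝ → 𝕋_φ`. -/
def proj : Cover φ → MappingTorus φ := Quotient.mk (AddAction.orbitRel ℤ (Cover φ))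

lemma proj_surjective : Function.Surjective (proj φ) := Quotient.mk_surjective

lemma proj_eq_iff (p p' : Cover φ) : proj φ p = proj φ p' ↔ ∃ n : ℤ, n +ᵥ p = p' := by
  rw [eq_comm]
  exact Quotient.eq''

lemma proj_vadd (n : ℤ) (p : Cover φ) : proj φ (n +ᵥ p) = proj φ p :=
  ((proj_eq_iff φ _ _).2 ⟨n, rfl⟩).symm

lemma isLocalHomeomorph_proj : IsLocalHomeomorph (proj φ) :=
  (isAddQuotientCoveringMap_quotientMk_of_properlyDiscontinuousVAdd.isCoveringMap
    (proj φ) ℤ).isLocalHomeomorph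

instance : ChartedSpace (ModelProd H ℝ) (MappingTorus φ) :=
  (isLocalHomeomorph_proj φ).chartedSpace (proj_surjective φ)

lemma hasDeck : HasDeck (I.prod 𝓘(ℝ, ℝ)) (proj φ) := by
  intro p p' h
  obtain ⟨n, hn⟩ := (proj_eq_iff φ _ _).1 h
  exact ⟨_, Cover.contMDiff_vadd φ n, hn, proj_vadd φ n⟩

variable [IsManifold I ∞ L] [I.Boundaryless]

instance : IsManifold (I.prod 𝓘(ℝ, ℝ)) ∞ (MappingTorus φ) :=
  (hasDeck φ).isManifold (isLocalHomeomorph_proj φ) (proj_surjective φ)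

/-- The points of `L × ℝ` used to define the charts of `𝕋_φ`. -/
def basePoint : MappingTorus φ → Cover φ := (proj_surjective φ).hasRightInverse.choose

lemma isQuotientAtlas : IsQuotientAtlas (H := ModelProd H ℝ) (isLocalHomeomorph_proj φ)
    (basePoint φ) :=
  ⟨(proj_surjective φ).hasRightInverse.choose_spec, fun _ => rfl⟩

lemma contMDiff_proj : ContMDiff (I.prod 𝓘(ℝ, ℝ)) (I.prod 𝓘(ℝ, ℝ)) ∞ (proj φ) :=
  contMDiff_quotient (hasDeck φ) (isQuotientAtlas φ)

end MappingTorus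
end MappingTorus

/-! ### Model Lie affine foliations -/

namespace MappingTorus

section Model

variable {E : Type*} [NormedAddCommGroup E] [NormedSpace ℝ E] {H : Type*} [TopologicalSpace H]
  {I : ModelWithCorners ℝ E H} {L : Type*} [TopologicalSpace L] [ChartedSpace H L]
  [T2Space L] [CompactSpace L] [IsManifold I ∞ L] [I.Boundaryless] (φ : L ≃ₘ⟮I, I⟯ L) {k : ℕ}

lemma pull_deck {w : Cover φ → (E × ℝ) [⋀^Fin k]→L[ℝ] ℝ}
    (hw : pull (I.prod 𝓘(ℝ, ℝ)) (I.prod 𝓘(ℝ, ℝ)) (fun p : Cover φ => (1 : ℤ) +ᵥ p) w = w)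
    (d : Cover φ → Cover φ) (hd : ContMDiff (I.prod 𝓘(ℝ, ℝ)) (I.prod 𝓘(ℝ, ℝ)) ∞ d)
    (hdq : ∀ z, proj φ (d z) = proj φ z) :
    pull (I.prod 𝓘(ℝ, ℝ)) (I.prod 𝓘(ℝ, ℝ)) d w = w := by
  have hdiff : ∀ (n : ℤ) (p : Cover φ), MDifferentiableAt (I.prod 𝓘(ℝ, ℝ)) (I.prod 𝓘(ℝ, ℝ))
      (fun p : Cover φ => n +ᵥ p) p := fun n p =>
    (Cover.contMDiff_vadd φ n).mdifferentiableAt (by simp)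
  have hcomp : ∀ (m n : ℤ), pull (I.prod 𝓘(ℝ, ℝ)) (I.prod 𝓘(ℝ, ℝ))
      (fun p : Cover φ => (m + n) +ᵥ p) w = pull (I.prod 𝓘(ℝ, ℝ)) (I.prod 𝓘(ℝ, ℝ))
      (fun p : Cover φ => n +ᵥ p) (pull (I.prod 𝓘(ℝ, ℝ)) (I.prod 𝓘(ℝ, ℝ))
      (fun p : Cover φ => m +ᵥ p) w) := by
    intro m n
    funext p
    rw [← pull_comp w (hdiff m _) (hdiff n p)]
    congr 1
    funext z
    exact add_vadd m n z
  have hzero : pull (I.prod 𝓘(ℝ, ℝ)) (I.prod 𝓘(ℝ, ℝ)) (fun p : Cover φ => (0 : ℤ) +ᵥ p) w = w := by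
    have : (fun p : Cover φ => (0 : ℤ) +ᵥ p) = id := funext fun p => zero_vadd ℤ p
    rw [this]
    funext p
    simp only [pull, mfderiv_id]
    rfl
  have hneg : pull (I.prod 𝓘(ℝ, ℝ)) (I.prod 𝓘(ℝ, ℝ))
      (fun p : Cover φ => (-1 : ℤ) +ᵥ p) w = w := by
    have h := hcomp 1 (-1)
    rw [hw] at h
    rw [← h]
    exact hzero
  have hall : ∀ n : ℤ, pull (I.prod 𝓘(ℝ, ℝ)) (I.prod 𝓘(ℝ, ℝ))
      (fun p : Cover φ => n +ᵥ p) w = w := by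
    intro n
    induction n with
    | zero => exact hzero
    | succ n ih => rw [hcomp, ih, hw]
    | pred n ih => rw [sub_eq_add_neg, hcomp, ih, hneg]
  funext p
  obtain ⟨n, hn⟩ := (proj_eq_iff φ _ _).1 (hdq p).symm
  have hq := isLocalHomeomorph_proj φ
  have hp : proj φ p ∈ (hq.localInverseAt (d p)).source := by
    rw [← hdq p]
    exact hq.apply_self_mem_localInverseAt_source
  have hs : d p = hq.localInverseAt (d p) (proj φ p) := by
    rw [← hdq p]
    exact hq.localInverseAt_apply_self.symm
  have e1 := section_comp_eventuallyEq hq (d p) p hp hd.continuous hs hdq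
  have e2 := section_comp_eventuallyEq hq (d p) p hp (Cover.contMDiff_vadd φ n).continuous
    (hn.trans hs) (proj_vadd φ n)
  rw [pull_congr w (e1.symm.trans e2), hall]

/-- A form on `L × ℝ` that is invariant under `(x, t) ↦ (φ x, t + 1)` descends to `𝕋_φ`. -/
def descendForm (w : Form (I.prod 𝓘(ℝ, ℝ)) (Cover φ) k)
    (hw : pullForm (fun p : Cover φ => (1 : ℤ) +ᵥ p) (Cover.contMDiff_vadd φ 1) w = w) :
    Form (I.prod 𝓘(ℝ, ℝ)) (MappingTorus φ) k :=
  ⟨descend (J := I.prod 𝓘(ℝ, ℝ)) (isLocalHomeomorph_proj φ) (basePoint φ) w.1,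
    descend_mem (hasDeck φ) (isQuotientAtlas φ) w.2 (pull_deck φ (congrArg Form.toFun hw))⟩

/-- `descendForm` is characterized by its pullback to `L × ℝ`. -/
lemma pullForm_descendForm (w : Form (I.prod 𝓘(ℝ, ℝ)) (Cover φ) k)
    (hw : pullForm (fun p : Cover φ => (1 : ℤ) +ᵥ p) (Cover.contMDiff_vadd φ 1) w = w) :
    pullForm (proj φ) (contMDiff_proj φ) (descendForm φ w hw) = w :=
  Form.ext (pull_descend (hasDeck φ) (isQuotientAtlas φ) (pull_deck φ (congrArg Form.toFun hw)))

lemma pullForm_proj_injective : Function.Injective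
    (pullForm (I := I.prod 𝓘(ℝ, ℝ)) (k := k) (proj φ) (contMDiff_proj φ)) := by
  intro w w' h
  ext1
  funext y
  rw [← pull_section (hasDeck φ) (isQuotientAtlas φ) w.1 y,
    ← pull_section (hasDeck φ) (isQuotientAtlas φ) w'.1 y]
  have h' : pull (I.prod 𝓘(ℝ, ℝ)) (I.prod 𝓘(ℝ, ℝ)) (proj φ) w.1 =
    pull (I.prod 𝓘(ℝ, ℝ)) (I.prod 𝓘(ℝ, ℝ)) (proj φ) w'.1 := congrArg Form.toFun h
  rw [h']

lemma contMDiff_fst' : ContMDiff (I.prod 𝓘(ℝ, ℝ)) I ∞ (fun p : Cover φ => p.1) :=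
  contMDiff_fst (M := L) (N := ℝ)

lemma contMDiff_snd' : ContMDiff (I.prod 𝓘(ℝ, ℝ)) 𝓘(ℝ, ℝ) ∞ (fun p : Cover φ => p.2) :=
  contMDiff_snd (M := L) (N := ℝ)

lemma contMDiff_expFun (lam : ℝ) : ContMDiff (I.prod 𝓘(ℝ, ℝ)) 𝓘(ℝ, ℝ) ∞
    (fun p : Cover φ => Real.exp (-lam * p.2)) :=
  (Real.contDiff_exp.comp (contDiff_const.mul contDiff_id)).contMDiff.comp (contMDiff_snd' φ)

/-- The one-form `e^{-λt} α` on `L × ℝ`. -/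
def coverForm₁ (α : Form I L 1) (lam : ℝ) : Form (I.prod 𝓘(ℝ, ℝ)) (Cover φ) 1 :=
  mulForm (ofFun (fun p : Cover φ => Real.exp (-lam * p.2)) (contMDiff_expFun φ lam))
    (pullForm (fun p : Cover φ => p.1) (contMDiff_fst' φ) α)

/-- The one-form `-λ dt` on `L × ℝ`. -/
def coverForm₂ (lam : ℝ) : Form (I.prod 𝓘(ℝ, ℝ)) (Cover φ) 1 :=
  -lam • extD (I.prod 𝓘(ℝ, ℝ)) (ofFun (fun p : Cover φ => p.2) (contMDiff_snd' φ))

lemma coverForm₁_eq (α : Form I L 1) (lam : ℝ) (p : Cover φ) :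
    (coverForm₁ φ α lam).1 p = Real.exp (-lam * p.2) •
      pull I (I.prod 𝓘(ℝ, ℝ)) (fun p : Cover φ => p.1) α.1 p := rfl

lemma mfderiv_fst' (p : Cover φ) : mfderiv (I.prod 𝓘(ℝ, ℝ)) I (fun p : Cover φ => p.1) p =
    ContinuousLinearMap.fst ℝ E ℝ := mfderiv_fst (M := L) (M' := ℝ)

lemma mfderiv_snd' (p : Cover φ) : mfderiv (I.prod 𝓘(ℝ, ℝ)) 𝓘(ℝ, ℝ) (fun p : Cover φ => p.2) p =
    ContinuousLinearMap.snd ℝ E ℝ := mfderiv_snd (M := L) (M' := ℝ)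

lemma coverForm₁_apply (α : Form I L 1) (lam : ℝ) (p : Cover φ) (v : Fin 1 → E × ℝ) :
    (coverForm₁ φ α lam).1 p v = Real.exp (-lam * p.2) * α.1 p.1 (fun i => (v i).1) := by
  rw [coverForm₁_eq, pull, mfderiv_fst']
  rfl

lemma coverForm₂_apply (lam : ℝ) (p : Cover φ) (v : Fin 1 → E × ℝ) :
    (coverForm₂ φ lam).1 p v = -lam * (v 0).2 := by
  have h : (coverForm₂ φ lam).1 p v = -lam * (extD (I.prod 𝓘(ℝ, ℝ))
    (ofFun (fun p : Cover φ => p.2) (contMDiff_snd' φ))).1 p v := rfl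
  rw [h, extD_ofFun, mfderiv_snd']
  rfl

lemma coverForm₁_invariant {α : Form I L 1} {lam : ℝ}
    (hφ : pullForm φ φ.contMDiff α = Real.exp lam • α) :
    pullForm (fun p : Cover φ => (1 : ℤ) +ᵥ p) (Cover.contMDiff_vadd φ 1) (coverForm₁ φ α lam) =
      coverForm₁ φ α lam := by
  have hφ' : pull I I φ α.1 = Real.exp lam • α.1 := congrArg Form.toFun hφ
  ext1
  funext p
  have h1 : (pullForm (fun p : Cover φ => (1 : ℤ) +ᵥ p) (Cover.contMDiff_vadd φ 1)
      (coverForm₁ φ α lam)).1 p = Real.exp (-lam * ((1 : ℤ) +ᵥ p).2) •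
        pull (I.prod 𝓘(ℝ, ℝ)) (I.prod 𝓘(ℝ, ℝ)) (fun p : Cover φ => (1 : ℤ) +ᵥ p)
          (pull I (I.prod 𝓘(ℝ, ℝ)) (fun p : Cover φ => p.1) α.1) p := rfl
  have h2 : pull (I.prod 𝓘(ℝ, ℝ)) (I.prod 𝓘(ℝ, ℝ)) (fun p : Cover φ => (1 : ℤ) +ᵥ p)
      (pull I (I.prod 𝓘(ℝ, ℝ)) (fun p : Cover φ => p.1) α.1) p =
      Real.exp lam • pull I (I.prod 𝓘(ℝ, ℝ)) (fun p : Cover φ => p.1) α.1 p := by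
    rw [← pull_comp α.1 ((contMDiff_fst' φ).mdifferentiableAt (by simp))
      ((Cover.contMDiff_vadd φ 1).mdifferentiableAt (by simp))]
    have h3 : (fun p : Cover φ => p.1) ∘ (fun p : Cover φ => (1 : ℤ) +ᵥ p) =
        φ ∘ (fun p : Cover φ => p.1) := by
      funext z
      exact congrArg Prod.fst (Cover.one_vadd φ z)
    rw [h3, pull_comp (I' := I) α.1 (φ.contMDiff.mdifferentiableAt (by simp))
      ((contMDiff_fst' φ).mdifferentiableAt (by simp)), hφ']
    rfl
  rw [h1, h2, coverForm₁_eq, smul_smul, ← Real.exp_add, Cover.one_vadd]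
  congr 2
  ring

lemma coverForm₂_invariant (lam : ℝ) :
    pullForm (fun p : Cover φ => (1 : ℤ) +ᵥ p) (Cover.contMDiff_vadd φ 1) (coverForm₂ φ lam) =
      coverForm₂ (φ := φ) lam := by
  rw [coverForm₂, map_smul, ← pullForm_extD]
  congr 1
  have hs : ContMDiff (I.prod 𝓘(ℝ, ℝ)) 𝓘(ℝ, ℝ) ∞ (fun p : Cover φ => ((1 : ℤ) +ᵥ p).2) :=
    (contMDiff_snd' φ).comp (Cover.contMDiff_vadd φ 1)
  have h1 : pullForm (fun p : Cover φ => (1 : ℤ) +ᵥ p) (Cover.contMDiff_vadd φ 1)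
      (ofFun (fun p : Cover φ => p.2) (contMDiff_snd' φ)) = ofFun _ hs := rfl
  rw [h1]
  ext1
  funext p
  rw [extD_ofFun, extD_ofFun]
  have h2 : (fun p : Cover φ => ((1 : ℤ) +ᵥ p).2) = fun p : Cover φ => p.2 + 1 := by
    funext z
    rw [Cover.one_vadd]
  have h4 : HasMFDerivAt 𝓘(ℝ, ℝ) 𝓘(ℝ, ℝ) (fun t : ℝ => t + 1) p.2 (ContinuousLinearMap.id ℝ ℝ) :=
    ((hasFDerivAt_id p.2).add_const 1).hasMFDerivAt
  have h5 : HasMFDerivAt (I.prod 𝓘(ℝ, ℝ)) 𝓘(ℝ, ℝ) (fun p : Cover φ => p.2) p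
      (mfderiv (I.prod 𝓘(ℝ, ℝ)) 𝓘(ℝ, ℝ) (fun p : Cover φ => p.2) p) :=
    ((contMDiff_snd' φ).mdifferentiableAt (by simp)).hasMFDerivAt
  have h3 := HasMFDerivAt.comp (I' := 𝓘(ℝ, ℝ)) (g := fun t : ℝ => t + 1)
    (f := fun p : Cover φ => p.2) p h4 h5
  rw [h2]
  exact congrArg _ h3.mfderiv

lemma extD_expFun (lam : ℝ) :
    extD (I.prod 𝓘(ℝ, ℝ))
      (ofFun (fun p : Cover φ => Real.exp (-lam * p.2)) (contMDiff_expFun φ lam)) =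
    mulForm (ofFun (fun p : Cover φ => Real.exp (-lam * p.2)) (contMDiff_expFun φ lam))
      (coverForm₂ φ lam) := by
  ext1
  funext p
  ext v
  have hd : HasDerivAt (fun t : ℝ => Real.exp (-lam * t)) (Real.exp (-lam * p.2) * (-lam)) p.2 := by
    have := ((hasDerivAt_id p.2).const_mul (-lam)).exp
    simpa using this
  have h5 : HasMFDerivAt (I.prod 𝓘(ℝ, ℝ)) 𝓘(ℝ, ℝ) (fun p : Cover φ => p.2) p
      (mfderiv (I.prod 𝓘(ℝ, ℝ)) 𝓘(ℝ, ℝ) (fun p : Cover φ => p.2) p) :=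
    ((contMDiff_snd' φ).mdifferentiableAt (by simp)).hasMFDerivAt
  have h1 : HasMFDerivAt (I.prod 𝓘(ℝ, ℝ)) 𝓘(ℝ, ℝ) (fun p : Cover φ => Real.exp (-lam * p.2)) p
      ((ContinuousLinearMap.toSpanSingleton ℝ (Real.exp (-lam * p.2) * (-lam))) ∘L
        mfderiv (I.prod 𝓘(ℝ, ℝ)) 𝓘(ℝ, ℝ) (fun p : Cover φ => p.2) p) :=
    HasMFDerivAt.comp (I' := 𝓘(ℝ, ℝ)) (g := fun t : ℝ => Real.exp (-lam * t))
      (f := fun p : Cover φ => p.2) p hd.hasFDerivAt.hasMFDerivAt h5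
  have h2 : (mulForm (ofFun (fun p : Cover φ => Real.exp (-lam * p.2)) (contMDiff_expFun φ lam))
      (coverForm₂ φ lam)).1 p v = Real.exp (-lam * p.2) * (coverForm₂ φ lam).1 p v := rfl
  rw [extD_ofFun, h1.mfderiv, h2, coverForm₂_apply, mfderiv_snd']
  change (v 0).2 * (Real.exp (-lam * p.2) * (-lam)) = _
  ring

lemma coverForm_eq₁ {α : Form I L 1} (hα : extD I α = 0) (lam : ℝ) :
    extD (I.prod 𝓘(ℝ, ℝ)) (coverForm₁ φ α lam) =
      wedgeForm (coverForm₂ φ lam) (coverForm₁ φ α lam) := by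
  have h0 : ∀ g : Form (I.prod 𝓘(ℝ, ℝ)) (Cover φ) 0,
      mulForm g (0 : Form (I.prod 𝓘(ℝ, ℝ)) (Cover φ) 2) = 0 := by
    intro g
    ext1
    funext x
    exact smul_zero _
  have h1 : ∀ (g : Form (I.prod 𝓘(ℝ, ℝ)) (Cover φ) 0) (θ β : Form (I.prod 𝓘(ℝ, ℝ)) (Cover φ) 1),
      wedgeForm (mulForm g θ) β = mulForm g (wedgeForm θ β) := by
    intro g θ β
    ext1
    funext x
    change wedgeL _ 1 (_ • _) _ = _ • wedgeL _ 1 _ _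
    simp
  rw [coverForm₁, extD_mul, pullForm_extD, hα, _root_.map_zero, h0, add_zero, extD_expFun, h1, wedge_mul]

/-- The model Lie affine foliation `(𝒢_{α,λ}, ω)` on the mapping torus `𝕋_φ`, where `α` is a closed
nowhere-vanishing one-form on `L` with `φ^* α = e^λ α` and `λ ≠ 0`: the pair of one-forms
`ω₁ = e^{-λt} α`, `ω₂ = -λ dt`. -/
def modelPair (α : Form I L 1) (lam : ℝ) (hα : extD I α = 0) (hne : ∀ x, α.covector x ≠ 0)
    (hφ : pullForm φ φ.contMDiff α = Real.exp lam • α) (hlam : lam ≠ 0) :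
    LieAffinePair (I.prod 𝓘(ℝ, ℝ)) (MappingTorus φ) where
  ω₁ := descendForm φ (coverForm₁ φ α lam) (coverForm₁_invariant φ hφ)
  ω₂ := descendForm φ (coverForm₂ φ lam) (coverForm₂_invariant φ lam)
  eq₁ := by
    rw [sub_eq_zero]
    apply pullForm_proj_injective φ
    rw [← pullForm_extD, pullForm_wedge, pullForm_descendForm, pullForm_descendForm,
      coverForm_eq₁ φ hα]
  eq₂ := by
    apply pullForm_proj_injective φ
    rw [← pullForm_extD, pullForm_descendForm, _root_.map_zero, coverForm₂, map_smul, extD_extD, smul_zero]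
  indep := by
    intro y
    obtain ⟨p, rfl⟩ := proj_surjective φ y
    rw [LinearIndependent.pair_iff]
    intro a b hab
    have h1 := congrArg (fun w => w.1 p) (pullForm_descendForm φ (coverForm₁ φ α lam)
      (coverForm₁_invariant φ hφ))
    have h2 := congrArg (fun w => w.1 p) (pullForm_descendForm φ (coverForm₂ φ lam)
      (coverForm₂_invariant φ lam))
    have key : ∀ v : E × ℝ, a * (coverForm₁ φ α lam).1 p (fun _ => v) +
        b * (coverForm₂ φ lam).1 p (fun _ => v) = 0 := by
      intro v
      have h := congrArg (fun w => w (mfderiv (I.prod 𝓘(ℝ, ℝ)) (I.prod 𝓘(ℝ, ℝ)) (proj φ) p v)) hab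
      rw [← h1, ← h2]
      exact h
    have hb : b = 0 := by
      have h := key (0, 1)
      rw [coverForm₁_apply, coverForm₂_apply] at h
      have h0 : α.1 p.1 (fun _ => (0 : E)) = 0 := (α.1 p.1).map_coord_zero 0 rfl
      simpa [h0, hlam] using h
    refine ⟨?_, hb⟩
    by_contra ha
    refine hne p.1 (ContinuousLinearMap.ext fun u => ?_)
    have h := key (u, 0)
    rw [coverForm₁_apply, hb] at h
    have h' : α.1 p.1 (fun _ => u) = 0 := by simpa [ha] using h
    exact h'

end Model
end MappingTorus

end LieAffine

end

namespace LieAffine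

open ContinuousAlternatingMap

set_option linter.unusedSectionVars false

section Gauge

variable {E : Type*} [NormedAddCommGroup E] [NormedSpace ℝ E] {H : Type*} [TopologicalSpace H]
  {M : Type*} [TopologicalSpace M] [ChartedSpace H M] {I : ModelWithCorners ℝ E H} {k : ℕ}

/-- The value of a zero-form at a point. -/
noncomputable def Form.val (g : Form I M 0) (x : M) : ℝ := zval E (g.1 x)

lemma Form.ext_val {g h : Form I M 0} (hv : ∀ x, g.val x = h.val x) : g = h := by
  ext1
  funext x
  ext v
  rw [← zval_apply, ← zval_apply]
  exact hv x

lemma Form.ext_covector {w w' : Form I M 1}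
    (h : ∀ x (v : E), w.1 x (fun _ => v) = w'.1 x (fun _ => v)) : w = w' := by
  ext1
  funext x
  ext v
  have hv : v = fun _ => v 0 := by
    funext i
    rw [Subsingleton.elim i 0]
  rw [hv]
  exact h x (v 0)

variable [IsManifold I ∞ M] [I.Boundaryless]

lemma mulForm_apply (g : Form I M 0) (β : Form I M k) (x : M) :
    (mulForm g β).1 x = g.val x • β.1 x := rfl

lemma val_ofFun (f : M → ℝ) (hf : ContMDiff I 𝓘(ℝ, ℝ) ∞ f) (x : M) : (ofFun f hf).val x = f x :=
  rfl

lemma val_mulForm (g h : Form I M 0) (x : M) : (mulForm g h).val x = g.val x * h.val x := by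
  simp [Form.val, mulForm_apply]

lemma mulForm_add (g : Form I M 0) (β β' : Form I M k) :
    mulForm g (β + β') = mulForm g β + mulForm g β' := by
  ext1; funext x; exact smul_add _ _ _

lemma mulForm_sub (g : Form I M 0) (β β' : Form I M k) :
    mulForm g (β - β') = mulForm g β - mulForm g β' := by
  ext1; funext x; exact smul_sub _ _ _

lemma mulForm_neg (g : Form I M 0) (β : Form I M k) :
    mulForm g (-β) = -mulForm g β := by
  ext1; funext x; exact smul_neg _ _

lemma mulForm_smul (g : Form I M 0) (c : ℝ) (β : Form I M k) :
    mulForm g (c • β) = c • mulForm g β := by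
  ext1; funext x; exact smul_comm (g.val x) c (β.1 x)

lemma mulForm_zero (g : Form I M 0) : mulForm g (0 : Form I M k) = 0 := by
  ext1; funext x; exact smul_zero _

lemma wedgeForm_mul_left (g : Form I M 0) (θ : Form I M 1) (β : Form I M k) :
    wedgeForm (mulForm g θ) β = mulForm g (wedgeForm θ β) := by
  ext1
  funext x
  change wedgeL E k (_ • _) _ = _ • wedgeL E k _ _
  simp

lemma mulForm_mulForm_of_inv {a b : Form I M 0} (hab : ∀ x, a.val x * b.val x = 1)
    (β : Form I M k) : mulForm a (mulForm b β) = β := by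
  ext1
  funext x
  rw [mulForm_apply, mulForm_apply, smul_smul, hab, one_smul]

lemma wedge_one_apply {V : Type*} [NormedAddCommGroup V] [NormedSpace ℝ V]
    (θ η : V [⋀^Fin 1]→L[ℝ] ℝ) (v w : V) :
    wedge θ η ![v, w] = θ (fun _ => v) * η (fun _ => w) - θ (fun _ => w) * η (fun _ => v) := by
  have e1 : (Fin.removeNth 0 ![v, w] : Fin 1 → V) = fun _ => w := by ext i; fin_cases i; rfl
  have e2 : (Fin.removeNth 1 ![v, w] : Fin 1 → V) = fun _ => v := by ext i; fin_cases i; rfl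
  rw [wedge_apply, Fin.sum_univ_two, e1, e2]
  simp
  ring

lemma wedgeForm_anticomm (θ η : Form I M 1) : wedgeForm θ η = -wedgeForm η θ := by
  ext1
  funext x
  ext v
  have hv : v = ![v 0, v 1] := by
    funext i
    fin_cases i <;> rfl
  rw [hv]
  change wedge (θ.1 x) (η.1 x) _ = -wedge (η.1 x) (θ.1 x) _
  rw [wedge_one_apply, wedge_one_apply]
  ring

lemma wedgeForm_zeroForm (θ : Form I M 1) (g : Form I M 0) : wedgeForm θ g = mulForm g θ := by
  refine Form.ext_covector fun x v => ?_
  change wedge _ _ _ = _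
  rw [wedge_apply, mulForm_apply]
  simp [Form.val, ← zval_apply, mul_comm]

/-- Multiplication by `a` intertwines `d_θ` and `d_η` when `da = a (η - θ)`. -/
lemma mnD_mulForm {a : Form I M 0} {θ η : Form I M 1} (ha : extD I a = mulForm a (η - θ))
    (β : Form I M k) : mnD η k (mulForm a β) = mulForm a (mnD θ k β) := by
  rw [mnD_apply, mnD_apply, extD_mul, ha, wedgeForm_mul_left, wedge_mul, mulForm_sub,
    map_sub, LinearMap.sub_apply, mulForm_sub]
  abel

/-- The product rule for `d_η (g γ)`, where `γ` is closed. -/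
lemma mnD_mulForm_of_closed (η : Form I M 1) (g : Form I M 0) {γ : Form I M 1}
    (hγ : extD I γ = 0) : mnD η 1 (mulForm g γ) = -wedgeForm γ (mnD η 0 g) := by
  rw [mnD_apply, mnD_apply, extD_mul, hγ, mulForm_zero, add_zero, map_sub, wedgeForm_zeroForm, wedge_mul, wedge_mul,
    wedgeForm_anticomm γ, wedgeForm_anticomm γ, mulForm_neg]
  abel

/-- Two pairs of forms are gauge equivalent if `ζ₂ = ω₂ + d log |a|` and `ζ₁ = a (ω₁ + d_{ω₂} h)`
for some functions `a`, `h` with `a` nowhere zero. -/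
def GaugeEquivalent (P Q : LieAffinePair I M) : Prop :=
  ∃ a b h : Form I M 0, (∀ x, a.val x * b.val x = 1) ∧ extD I a = mulForm a (Q.ω₂ - P.ω₂) ∧
    Q.ω₁ = mulForm a (P.ω₁ + mnD P.ω₂ 0 h)

lemma GaugeEquivalent.symm {P Q : LieAffinePair I M} (hPQ : GaugeEquivalent P Q) :
    GaugeEquivalent Q P := by
  obtain ⟨a, b, h, hab, ha, hQ⟩ := hPQ
  have hba : ∀ x, b.val x * a.val x = 1 := fun x => by rw [mul_comm, hab]
  have h1 : extD I (mulForm a b) = 0 := by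
    have h2 : mulForm a b = ofFun (fun _ => 1) contMDiff_const := Form.ext_val fun x => by
      rw [val_mulForm, hab, val_ofFun]
    refine Form.ext_covector fun x v => ?_
    rw [h2, extD_ofFun, mfderiv_const]
    rfl
  have hb : extD I b = mulForm b (P.ω₂ - Q.ω₂) := by
    have h3 : mulForm a (wedgeForm (Q.ω₂ - P.ω₂) b + extD I b) = 0 := by
      rw [extD_mul, ha, wedgeForm_mul_left] at h1
      rw [mulForm_add, h1]
    have h4 := congrArg (mulForm b) h3
    rw [mulForm_mulForm_of_inv hba, mulForm_zero, wedgeForm_zeroForm] at h4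
    rw [eq_neg_of_add_eq_zero_right h4, ← mulForm_neg, neg_sub]
  refine ⟨b, a, -mulForm a h, hba, hb, ?_⟩
  rw [map_neg, mnD_mulForm ha, hQ, mulForm_add, ← mulForm_neg, ← mulForm_add, ← mulForm_add,
    mulForm_mulForm_of_inv hba]
  abel

lemma mnClass_eq_zero_iff (θ : Form I M 1) (k : ℕ) (β : cocycles θ (k + 1)) :
    mnClass θ (k + 1) β = 0 ↔ ∃ η, mnD θ k η = β.1 := by
  rw [mnClass, Submodule.mkQ_apply, Submodule.Quotient.mk_eq_zero]
  rfl

lemma LieAffinePair.cohomologicalConditions_iff (P : LieAffinePair I M) :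
    P.CohomologicalConditions ↔
      (∀ β, mnD P.ω₂ 1 β = 0 → ∃ (c : ℝ) (g : Form I M 0), β = c • P.ω₁ + mnD P.ω₂ 0 g) ∧
      ∀ γ : Form I M 1, extD I γ = 0 → (∃ η, mnD P.ω₂ 1 η = wedgeForm γ P.ω₁) →
        ∃ g : Form I M 0, extD I g = γ := by
  refine and_congr ?_ ?_
  · rw [eq_comm, Submodule.eq_top_iff']
    constructor
    · intro h β hβ
      obtain ⟨c, hc⟩ := Submodule.mem_span_singleton.1 (h (mnClass P.ω₂ 1 ⟨β, hβ⟩))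
      rw [LieAffinePair.class₁, ← map_smul, eq_comm, ← sub_eq_zero, ← map_sub,
        mnClass_eq_zero_iff] at hc
      obtain ⟨g, hg⟩ := hc
      exact ⟨c, g, by rw [hg]; simp⟩
    · intro h y
      obtain ⟨⟨β, hβ⟩, rfl⟩ := Submodule.mkQ_surjective _ y
      obtain ⟨c, g, hg⟩ := h β hβ
      refine Submodule.mem_span_singleton.2 ⟨c, ?_⟩
      change _ = mnClass P.ω₂ 1 ⟨β, hβ⟩
      rw [LieAffinePair.class₁, ← map_smul, eq_comm, ← sub_eq_zero, ← map_sub,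
        mnClass_eq_zero_iff]
      exact ⟨g, by simp [hg]⟩
  · rw [injective_iff_map_eq_zero]
    have hc : ∀ γ : Form I M 1, γ ∈ cocycles (0 : Form I M 1) 1 ↔ extD I γ = 0 := fun γ => by
      rw [← mnD_zero]; rfl
    constructor
    · intro h γ hγ hη
      have := h (mnClass 0 1 ⟨γ, (hc γ).2 hγ⟩)
        (by rw [P.wedgeClass_mnClass, mnClass_eq_zero_iff]; exact hη)
      rw [mnClass_eq_zero_iff] at this
      simpa only [mnD_zero] using this
    · intro h y hy
      obtain ⟨⟨γ, hγ⟩, rfl⟩ := Submodule.mkQ_surjective _ y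
      change P.wedgeClass (mnClass 0 1 _) = 0 at hy
      change mnClass 0 1 _ = 0
      rw [P.wedgeClass_mnClass, mnClass_eq_zero_iff] at hy
      rw [mnClass_eq_zero_iff]
      simpa only [mnD_zero] using h γ ((hc γ).1 hγ) hy

lemma GaugeEquivalent.cohomologicalConditions {P Q : LieAffinePair I M} (hPQ : GaugeEquivalent P Q)
    (hP : P.CohomologicalConditions) : Q.CohomologicalConditions := by
  obtain ⟨a, b, h, hab, ha, hQ⟩ := hPQ
  have hba : ∀ x, b.val x * a.val x = 1 := fun x => by rw [mul_comm, hab]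
  rw [LieAffinePair.cohomologicalConditions_iff] at hP ⊢
  obtain ⟨hP1, hP2⟩ := hP
  have hcancel : ∀ {k : ℕ} {β β' : Form I M k}, mulForm a β = mulForm a β' → β = β' := by
    intro k β β' he
    rw [← mulForm_mulForm_of_inv hba β, he, mulForm_mulForm_of_inv hba]
  constructor
  · intro β hβ
    have h1 : mnD P.ω₂ 1 (mulForm b β) = 0 := hcancel (by
      rw [← mnD_mulForm ha, mulForm_mulForm_of_inv hab, hβ, mulForm_zero])
    obtain ⟨c, g, hg⟩ := hP1 _ h1
    refine ⟨c, mulForm a (g - c • h), ?_⟩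
    rw [mnD_mulForm ha, hQ, ← mulForm_smul, ← mulForm_add, ← mulForm_mulForm_of_inv hab β, hg]
    congr 1
    simp
  · rintro γ hγ ⟨η, hη⟩
    refine hP2 γ hγ ⟨mulForm b η + mulForm h γ, hcancel ?_⟩
    rw [map_add, mulForm_add, ← mnD_mulForm ha, mulForm_mulForm_of_inv hab, hη,
      mnD_mulForm_of_closed _ _ hγ, hQ, wedge_mul, ← mulForm_add, map_add]
    congr 1
    abel

lemma GaugeEquivalent.cohomologicalConditions_iff {P Q : LieAffinePair I M}
    (hPQ : GaugeEquivalent P Q) : P.CohomologicalConditions ↔ Q.CohomologicalConditions :=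
  ⟨hPQ.cohomologicalConditions, hPQ.symm.cohomologicalConditions⟩

end Gauge

section Coefficients

lemma exists_eq_smul_of_ker_le {V : Type*} [AddCommGroup V] [Module ℝ V] [TopologicalSpace V]
    {f g : V →L[ℝ] ℝ} (hf : f ≠ 0) (h : ∀ v, f v = 0 → g v = 0) : ∃ c : ℝ, g = c • f := by
  obtain ⟨u, hu⟩ : ∃ u, f u ≠ 0 := by
    by_contra! h0
    exact hf (ContinuousLinearMap.ext h0)
  refine ⟨g u / f u, ContinuousLinearMap.ext fun v => ?_⟩
  have h1 := h (v - (f v / f u) • u) (by simp [hu])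
  rw [map_sub, map_smul, sub_eq_zero, smul_eq_mul] at h1
  rw [h1, _root_.smul_apply, smul_eq_mul]
  field_simp

lemma exists_dual_vector {V : Type*} [AddCommGroup V] [Module ℝ V] [TopologicalSpace V]
    {f g : V →L[ℝ] ℝ} (h : LinearIndependent ℝ ![f, g]) : ∃ v, f v = 1 ∧ g v = 0 := by
  by_contra! hv
  have hg : g ≠ 0 := h.ne_zero 1
  obtain ⟨c, hc⟩ := exists_eq_smul_of_ker_le (f := g) (g := f) hg (by
    intro v hgv
    by_contra hfv
    exact hv ((f v)⁻¹ • v) (by simp [hfv]) (by simp [hgv]))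
  have := (LinearIndependent.pair_iff.1 h) 1 (-c) (by rw [hc]; simp)
  exact one_ne_zero this.1

variable {E : Type*} [NormedAddCommGroup E] [NormedSpace ℝ E] {H : Type*} [TopologicalSpace H]
  {M : Type*} [TopologicalSpace M] [ChartedSpace H M] {I : ModelWithCorners ℝ E H} {k : ℕ}
  [IsManifold I ∞ M] [I.Boundaryless]

lemma exists_dual_tangent {ω₁ ω₂ : Form I M 1} {x : M}
    (h : LinearIndependent ℝ ![ω₁.covector x, ω₂.covector x]) :
    (∃ v : E, ω₁.1 x (fun _ => v) = 1 ∧ ω₂.1 x (fun _ => v) = 0) ∧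
      ∃ w : E, ω₂.1 x (fun _ => w) = 1 ∧ ω₁.1 x (fun _ => w) = 0 :=
  ⟨exists_dual_vector h, exists_dual_vector (LinearIndependent.pair_symm_iff.1 h)⟩

lemma inChart_self_comp (w : M → E [⋀^Fin k]→L[ℝ] ℝ) (x : M) :
    (inChart I x w (extChartAt I x x)).compContinuousLinearMap
      (mfderiv I 𝓘(ℝ, E) (extChartAt I x) x) = w x := by
  have h1 : (id : M → M) =ᶠ[𝓝 x] (extChartAt I x).symm ∘ extChartAt I x := by
    filter_upwards [extChartAt_source_mem_nhds (I := I) x] with z hz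
    exact ((extChartAt I x).left_inv hz).symm
  have h2 : pull I I id w x = w x := by
    simp only [pull, mfderiv_id]
    rfl
  rw [← h2, pull_congr w h1, pull_comp (I' := 𝓘(ℝ, E)) w]
  · rfl
  · exact ((contMDiffOn_chart_symm x).contMDiffAt
      (extChartAt_target_mem_nhds x)).mdifferentiableAt (by simp)
  · exact mdifferentiableAt_extChartAt (mem_chart_source H x)

lemma Form.contDiffAt_inChart (w : Form I M k) (x : M) :
    ContDiffAt ℝ ∞ (inChart I x w.1) (extChartAt I x x) :=
  (w.2 x).contDiffAt (extChartAt_target_mem_nhds x)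

/-- The expression in the chart at `x` of a one-form, applied to a constant vector. -/
noncomputable def chartEval (x : M) (w : Form I M 1) (v : E) (y : E) : ℝ :=
  inChart I x w.1 y (fun _ => v)

lemma contDiffAt_chartEval (x : M) (w : Form I M 1) (v : E) :
    ContDiffAt ℝ ∞ (chartEval x w v) (extChartAt I x x) :=
  (ContinuousAlternatingMap.apply ℝ E ℝ (fun _ : Fin 1 => v)).contDiff.contDiffAt.comp _
    (w.contDiffAt_inChart x)

lemma chartEval_self (x : M) (w : Form I M 1) (v : E) :
    chartEval x w (mfderiv I 𝓘(ℝ, E) (extChartAt I x) x v) (extChartAt I x x) =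
      w.1 x (fun _ => v) := by
  conv_rhs => rw [← inChart_self_comp (I := I) w.1 x]
  rfl

lemma contMDiff_coefficient {ω₁ ω₂ ζ : Form I M 1} {a b : M → ℝ}
    (hind : ∀ x, LinearIndependent ℝ ![ω₁.covector x, ω₂.covector x])
    (h : ∀ x, ζ.1 x = a x • ω₁.1 x + b x • ω₂.1 x) : ContMDiff I 𝓘(ℝ, ℝ) ∞ a := by
  intro x
  obtain ⟨⟨v, hv1, hv2⟩, w, hw2, hw1⟩ := exists_dual_tangent (hind x)
  set c := extChartAt I x
  set v' : E := mfderiv I 𝓘(ℝ, E) c x v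
  set w' : E := mfderiv I 𝓘(ℝ, E) c x w
  let det : E → ℝ := fun y => chartEval x ω₁ v' y * chartEval x ω₂ w' y -
    chartEval x ω₁ w' y * chartEval x ω₂ v' y
  have hdet : ContDiffAt ℝ ∞ det (c x) :=
    ((contDiffAt_chartEval x ω₁ v').mul (contDiffAt_chartEval x ω₂ w')).sub
      ((contDiffAt_chartEval x ω₁ w').mul (contDiffAt_chartEval x ω₂ v'))
  have hdet1 : det (c x) ≠ 0 := by
    simp only [det, v', w', c]
    rw [chartEval_self, chartEval_self, chartEval_self, chartEval_self, hv1, hv2, hw1, hw2]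
    norm_num
  have hnum : ContDiffAt ℝ ∞ (fun y => (chartEval x ζ v' y * chartEval x ω₂ w' y -
      chartEval x ζ w' y * chartEval x ω₂ v' y) / det y) (c x) :=
    (((contDiffAt_chartEval x ζ v').mul (contDiffAt_chartEval x ω₂ w')).sub
      ((contDiffAt_chartEval x ζ w').mul (contDiffAt_chartEval x ω₂ v'))).div hdet hdet1
  have heval : ∀ u y, chartEval x ζ u y = a (c.symm y) * chartEval x ω₁ u y +
      b (c.symm y) * chartEval x ω₂ u y := by
    intro u y
    simp only [chartEval, inChart, pull, h]
    rfl
  rw [contMDiffAt_iff_source]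
  refine ContMDiffAt.contMDiffWithinAt (contMDiffAt_iff_contDiffAt.2 ?_)
  refine hnum.congr_of_eventuallyEq ?_
  filter_upwards [hdet.continuousAt.eventually_ne hdet1] with y hy
  rw [Function.comp_apply, eq_div_iff hy, heval, heval]
  ring

lemma LieAffinePair.exists_coefficients (P : LieAffinePair I M) (ζ : Form I M 1)
    (h : ∀ x, P.tangentDistribution x ≤ (ζ.covector x).ker) :
    ∃ a b : Form I M 0, ζ = mulForm a P.ω₁ + mulForm b P.ω₂ := by
  have hex : ∀ x, ∃ a b : ℝ, ζ.1 x = a • P.ω₁.1 x + b • P.ω₂.1 x := by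
    intro x
    obtain ⟨⟨v, hv1, hv2⟩, w, hw2, hw1⟩ := exists_dual_tangent (P.indep x)
    let f₁ : E →L[ℝ] ℝ := P.ω₁.covector x
    let f₂ : E →L[ℝ] ℝ := P.ω₂.covector x
    let z : E →L[ℝ] ℝ := ζ.covector x
    change f₁ v = 1 at hv1
    change f₂ v = 0 at hv2
    change f₁ w = 0 at hw1
    change f₂ w = 1 at hw2
    refine ⟨z v, z w, ?_⟩
    have key : ∀ u : E, z u = z v * f₁ u + z w * f₂ u := by
      intro u
      have h1 : z (u - f₁ u • v - f₂ u • w) = 0 := by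
        refine h x ⟨?_, ?_⟩
        · change f₁ (u - f₁ u • v - f₂ u • w) = 0
          simp [hv1, hw1]
        · change f₂ (u - f₁ u • v - f₂ u • w) = 0
          simp [hv2, hw2]
      simp only [map_sub, map_smul, smul_eq_mul] at h1
      linarith
    ext u
    have hu : u = fun _ => u 0 := by
      funext i
      rw [Subsingleton.elim i 0]
    rw [hu]
    exact key (u 0)
  choose a b hab using hex
  refine ⟨ofFun a (contMDiff_coefficient P.indep hab),
    ofFun b (contMDiff_coefficient (fun x => LinearIndependent.pair_symm_iff.1 (P.indep x))
      fun x => by rw [hab, add_comm]), ?_⟩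
  ext1
  funext x
  exact hab x

end Coefficients

section Oscillation

variable {E : Type*} [NormedAddCommGroup E] [NormedSpace ℝ E] {H : Type*} [TopologicalSpace H]
  {L : Type*} [TopologicalSpace L] [ChartedSpace H L] {I : ModelWithCorners ℝ E H}
  [IsManifold I ∞ L] [I.Boundaryless]

/-- `|θ| ≤ K |α|` at every point and on every tangent vector. -/
def DominatedBy (θ α : Form I L 1) (K : ℝ) : Prop :=
  ∀ x (v : E), |θ.1 x (fun _ => v)| ≤ K * |α.1 x (fun _ => v)|

lemma fderiv_zval_apply {g : E → E [⋀^Fin 0]→L[ℝ] ℝ} {y : E} (hg : DifferentiableAt ℝ g y)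
    (v : E) : fderiv ℝ (fun y => zval E (g y)) y v = extDeriv g y (fun _ => v) := by
  have h1 : HasFDerivAt (fun y => zval E (g y)) (zval E ∘L fderiv ℝ g y) y :=
    (zval E).hasFDerivAt.comp y hg.hasFDerivAt
  have e1 : extDeriv g y (fun _ => v) = ∑ i : Fin 1, (-1 : ℤ) ^ (i : ℕ) •
      fderiv ℝ g y v (i.removeNth fun _ => v) := alternatizeUncurryFin_apply _ _
  rw [h1.fderiv, e1, ContinuousLinearMap.comp_apply, zval_apply _ (Fin.tail fun _ => v)]
  simp

lemma exists_local_oscillation_bound (α : Form I L 1) (x : L) :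
    ∃ U ∈ 𝓝 x, ∃ C : ℝ, ∀ (f : Form I L 0) (K : ℝ), 0 ≤ K → DominatedBy (extD I f) α K →
      ∀ y ∈ U, |f.val y - f.val x| ≤ C * K := by
  set c := extChartAt I x with hc
  set B := ‖inChart I x α.1 (c x)‖ + 1 with hB
  have hev : ∀ᶠ z in 𝓝 (c x), z ∈ c.target ∧ ‖inChart I x α.1 z‖ < B :=
    (show ∀ᶠ z in 𝓝 (c x), z ∈ c.target from extChartAt_target_mem_nhds x).and
      ((α.contDiffAt_inChart x).continuousAt.norm.eventually_lt continuousAt_const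
        (lt_add_one _))
  obtain ⟨r, hr, hball⟩ := Metric.eventually_nhds_iff_ball.1 hev
  refine ⟨c ⁻¹' Metric.ball (c x) r ∩ c.source, Filter.inter_mem
    ((continuousAt_extChartAt x).preimage_mem_nhds (Metric.ball_mem_nhds _ hr))
    (extChartAt_source_mem_nhds x), B * r, fun f K hK hf y hy => ?_⟩
  let F : E → ℝ := fun z => zval E (inChart I x f.1 z)
  have hF : ∀ u ∈ c.source, F (c u) = f.val u := by
    intro u hu
    have h1 : F (c u) = zval E (f.1 (c.symm (c u))) := zval_comp _ _
    rw [h1, c.left_inv hu]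
    rfl
  have hdiff : ∀ z ∈ Metric.ball (c x) r, DifferentiableAt ℝ F z := fun z hz =>
    (zval E).differentiableAt.comp z (f.diffAt x (hball z hz).1)
  have hbound : ∀ z ∈ Metric.ball (c x) r, ‖fderiv ℝ F z‖ ≤ B * K := by
    intro z hz
    have hB0 : 0 ≤ B := by positivity
    refine ContinuousLinearMap.opNorm_le_bound _ (by positivity) fun v => ?_
    rw [fderiv_zval_apply (f.diffAt x (hball z hz).1), ← inChart_extD f x (hball z hz).1]
    calc ‖inChart I x (extD I f).1 z (fun _ => v)‖ ≤ K * ‖inChart I x α.1 z (fun _ => v)‖ :=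
          hf _ _
      _ ≤ K * (B * ‖v‖) := by
          gcongr
          refine ((inChart I x α.1 z).le_opNorm _).trans ?_
          rw [Fin.prod_univ_one]
          gcongr
          exact (hball z hz).2.le
      _ = B * K * ‖v‖ := by ring
  have h := (convex_ball (c x) r).norm_image_sub_le_of_norm_fderiv_le (𝕜 := ℝ) hdiff hbound
    (Metric.mem_ball_self hr) hy.1
  rw [hF y hy.2, hF x (mem_extChartAt_source x), Real.norm_eq_abs] at h
  refine h.trans ?_
  have h2 : ‖c y - c x‖ ≤ r := by
    rw [← dist_eq_norm]
    exact (Metric.mem_ball.1 hy.1).le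
  have hB0 : 0 ≤ B := by positivity
  calc B * K * ‖c y - c x‖ ≤ B * K * r := by gcongr
    _ = B * r * K := by ring

lemma exists_oscillation_bound [CompactSpace L] [ConnectedSpace L] (α : Form I L 1) :
    ∃ C : ℝ, ∀ (f : Form I L 0) (K : ℝ), 0 ≤ K → DominatedBy (extD I f) α K →
      ∀ x y, |f.val x - f.val y| ≤ C * K := by
  obtain ⟨x₀⟩ := (inferInstance : Nonempty L)
  let S : Set L := {x | ∃ C : ℝ, ∀ (f : Form I L 0) (K : ℝ), 0 ≤ K →
    DominatedBy (extD I f) α K → |f.val x - f.val x₀| ≤ C * K}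
  have hS : S = Set.univ := by
    refine IsClopen.eq_univ ⟨?_, ?_⟩ ⟨x₀, 0, fun f K _ _ => by simp⟩
    · refine isClosed_of_closure_subset fun x hx => ?_
      obtain ⟨U, hU, C, hC⟩ := exists_local_oscillation_bound α x
      obtain ⟨y, hyU, C', hC'⟩ := mem_closure_iff_nhds.1 hx U hU
      refine ⟨C + C', fun f K hK hf => ?_⟩
      have h1 := hC f K hK hf y hyU
      have h2 := hC' f K hK hf
      rw [abs_le] at h1 h2 ⊢
      constructor <;> linarith
    · refine isOpen_iff_mem_nhds.2 fun x ⟨C', hC'⟩ => ?_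
      obtain ⟨U, hU, C, hC⟩ := exists_local_oscillation_bound α x
      refine Filter.mem_of_superset hU fun y hyU => ⟨C + C', fun f K hK hf => ?_⟩
      have h1 := hC f K hK hf y hyU
      have h2 := hC' f K hK hf
      rw [abs_le] at h1 h2 ⊢
      constructor <;> linarith
  obtain ⟨C, hC⟩ : ∃ C : ℝ, ∀ y ∈ (Set.univ : Set L), ∀ (f : Form I L 0) (K : ℝ), 0 ≤ K →
      DominatedBy (extD I f) α K → |f.val y - f.val x₀| ≤ C * K := by
    refine isCompact_univ.induction_on (p := fun s => ∃ C : ℝ, ∀ y ∈ s, ∀ (f : Form I L 0)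
      (K : ℝ), 0 ≤ K → DominatedBy (extD I f) α K → |f.val y - f.val x₀| ≤ C * K) ?_ ?_ ?_ ?_
    · exact ⟨0, fun y hy => hy.elim⟩
    · rintro s t hst ⟨C, hC⟩
      exact ⟨C, fun y hy => hC y (hst hy)⟩
    · rintro s t ⟨C, hC⟩ ⟨C', hC'⟩
      refine ⟨max C C', fun y hy f K hK hf => ?_⟩
      rcases hy with hy | hy
      · exact (hC y hy f K hK hf).trans (by gcongr; exact le_max_left _ _)
      · exact (hC' y hy f K hK hf).trans (by gcongr; exact le_max_right _ _)
    · intro x _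
      obtain ⟨C', hC'⟩ : x ∈ S := hS ▸ Set.mem_univ x
      obtain ⟨U, hU, C, hC⟩ := exists_local_oscillation_bound α x
      refine ⟨U, mem_nhdsWithin_of_mem_nhds hU, C + C', fun y hyU f K hK hf => ?_⟩
      have h1 := hC f K hK hf y hyU
      have h2 := hC' f K hK hf
      rw [abs_le] at h1 h2 ⊢
      constructor <;> linarith
  refine ⟨C + C, fun f K hK hf x y => ?_⟩
  have h1 := hC x (Set.mem_univ x) f K hK hf
  have h2 := hC y (Set.mem_univ y) f K hK hf
  rw [abs_le] at h1 h2 ⊢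
  constructor <;> linarith

lemma exists_dominatedBy [CompactSpace L] {θ α : Form I L 1} (hne : ∀ x, α.covector x ≠ 0)
    (h : ∀ x (v : E), α.1 x (fun _ => v) = 0 → θ.1 x (fun _ => v) = 0) :
    ∃ K, 0 ≤ K ∧ DominatedBy θ α K := by
  obtain ⟨K, hK0, hK⟩ : ∃ K, 0 ≤ K ∧ ∀ x ∈ (Set.univ : Set L), ∀ v : E,
      |θ.1 x (fun _ => v)| ≤ K * |α.1 x (fun _ => v)| := by
    refine isCompact_univ.induction_on (p := fun s => ∃ K, 0 ≤ K ∧ ∀ x ∈ s, ∀ v : E,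
      |θ.1 x (fun _ => v)| ≤ K * |α.1 x (fun _ => v)|) ?_ ?_ ?_ ?_
    · exact ⟨0, le_rfl, fun y hy => hy.elim⟩
    · rintro s t hst ⟨C, h0, hC⟩
      exact ⟨C, h0, fun y hy => hC y (hst hy)⟩
    · rintro s t ⟨C, h0, hC⟩ ⟨C', -, hC'⟩
      refine ⟨max C C', le_max_of_le_left h0, fun y hy v => ?_⟩
      rcases hy with hy | hy
      · exact (hC y hy v).trans (by gcongr; exact le_max_left _ _)
      · exact (hC' y hy v).trans (by gcongr; exact le_max_right _ _)
    · intro x _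
      set c := extChartAt I x
      obtain ⟨v₀, hv₀⟩ : ∃ v : E, α.1 x (fun _ => v) ≠ 0 := by
        by_contra! h0
        exact hne x (ContinuousLinearMap.ext h0)
      set v' : E := mfderiv I 𝓘(ℝ, E) c x v₀
      have hα : chartEval x α v' (c x) ≠ 0 := by
        rwa [chartEval_self]
      have hcα := (contDiffAt_chartEval x α v').continuousAt
      have hq : ContinuousAt (fun z => |chartEval x θ v' z / chartEval x α v' z|) (c x) :=
        ((contDiffAt_chartEval x θ v').continuousAt.div hcα hα).abs
      set K := |chartEval x θ v' (c x) / chartEval x α v' (c x)| + 1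
      have hev := (hq.eventually_lt continuousAt_const (lt_add_one _)).and
        (hcα.eventually_ne hα)
      have hK0 : 0 ≤ K := by positivity
      refine ⟨c.source ∩ c ⁻¹' _, mem_nhdsWithin_of_mem_nhds (Filter.inter_mem
        (extChartAt_source_mem_nhds x) ((continuousAt_extChartAt x).preimage_mem_nhds hev)),
        K, hK0, fun y hy v => ?_⟩
      obtain ⟨hy, hyK, hy0⟩ := hy
      set u : E := mfderiv 𝓘(ℝ, E) I c.symm (c y) v'
      have hu : ∀ β : Form I L 1, chartEval x β v' (c y) = β.1 y (fun _ => u) := by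
        intro β
        have : chartEval x β v' (c y) = β.1 (c.symm (c y)) (fun _ => u) := rfl
        rw [this, c.left_inv hy]
      rw [hu] at hy0
      simp only [hu] at hyK
      obtain ⟨b, hb⟩ := exists_eq_smul_of_ker_le (f := α.covector y) (g := θ.covector y) (hne y)
        (h y)
      have hb' : ∀ w : E, θ.1 y (fun _ => w) = b * α.1 y (fun _ => w) := fun w =>
        DFunLike.congr_fun hb w
      rw [hb', mul_div_cancel_right₀ _ hy0] at hyK
      rw [hb', abs_mul]
      gcongr
  exact ⟨K, hK0, fun x v => hK x (Set.mem_univ x) v⟩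

/-- A function constant along the leaves of `ker α` is constant if `α` is contracted by a
diffeomorphism. -/
lemma val_eq_of_contraction [CompactSpace L] [ConnectedSpace L] {α : Form I L 1}
    (hne : ∀ x, α.covector x ≠ 0) (ψ : L ≃ₘ⟮I, I⟯ L) {c : ℝ} (hc0 : 0 ≤ c) (hc1 : c < 1)
    (hψ : pullForm ψ ψ.contMDiff α = c • α) (f : Form I L 0)
    (hf : ∀ x (v : E), α.1 x (fun _ => v) = 0 → (extD I f).1 x (fun _ => v) = 0) (x y : L) :
    f.val x = f.val y := by
  obtain ⟨C, hC⟩ := exists_oscillation_bound α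
  have key : ∀ (n : ℕ) (f : Form I L 0) (K : ℝ), 0 ≤ K → DominatedBy (extD I f) α K →
      ∀ x y, |f.val x - f.val y| ≤ C * (c ^ n * K) := by
    intro n
    induction n with
    | zero => simpa using hC
    | succ n ih =>
      intro f K hK hf x y
      have hdom : DominatedBy (extD I (pullForm ψ ψ.contMDiff f)) α (c * K) := by
        intro z v
        have h1 : c * α.1 z (fun _ => v) = α.1 (ψ z) (fun _ => mfderiv I I ψ z v) :=
          (congrArg (fun w : Form I L 1 => w.1 z (fun _ => v)) hψ).symm
        rw [pullForm_extD]
        refine (hf (ψ z) (mfderiv I I ψ z v)).trans_eq ?_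
        rw [← h1, abs_mul, abs_of_nonneg hc0]
        ring
      have h2 := ih (pullForm ψ ψ.contMDiff f) (c * K) (by positivity) hdom
        (ψ.symm x) (ψ.symm y)
      have h3 : ∀ z, (pullForm ψ ψ.contMDiff f).val z = f.val (ψ z) := fun z => zval_comp _ _
      rw [h3, h3, ψ.apply_symm_apply, ψ.apply_symm_apply] at h2
      rw [pow_succ, mul_assoc]
      exact h2
  obtain ⟨K, hK, hdom⟩ := exists_dominatedBy hne hf
  have hlim : Filter.Tendsto (fun n : ℕ => C * (c ^ n * K)) Filter.atTop (𝓝 0) := by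
    simpa using ((tendsto_pow_atTop_nhds_zero_of_lt_one hc0 hc1).mul_const K).const_mul C
  have h0 := ge_of_tendsto' hlim fun n => key n f K hK hdom x y
  exact sub_eq_zero.1 (abs_nonpos_iff.1 h0)

lemma val_eq_of_conformal [CompactSpace L] [ConnectedSpace L] {α : Form I L 1}
    (hne : ∀ x, α.covector x ≠ 0) (φ : L ≃ₘ⟮I, I⟯ L) {lam : ℝ} (hlam : lam ≠ 0)
    (hφ : pullForm φ φ.contMDiff α = Real.exp lam • α) (f : Form I L 0)
    (hf : ∀ x (v : E), α.1 x (fun _ => v) = 0 → (extD I f).1 x (fun _ => v) = 0) (x y : L) :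
    f.val x = f.val y := by
  rcases lt_or_gt_of_ne hlam with h | h
  · exact val_eq_of_contraction hne φ (Real.exp_pos _).le (Real.exp_lt_one_iff.2 h) hφ f hf x y
  · refine val_eq_of_contraction hne φ.symm (c := Real.exp (-lam)) (Real.exp_pos _).le
      (Real.exp_lt_one_iff.2 (neg_lt_zero.2 h)) ?_ f hf x y
    have h1 : pullForm φ.symm φ.symm.contMDiff (pullForm φ φ.contMDiff α) = α := by
      ext1
      funext z
      change pull I I φ.symm (pull I I φ α.1) z = α.1 z
      rw [← pull_comp α.1 (φ.contMDiff.mdifferentiableAt (by simp))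
        (φ.symm.contMDiff.mdifferentiableAt (by simp))]
      have h2 : (φ : L → L) ∘ φ.symm = id := funext φ.apply_symm_apply
      rw [h2]
      simp only [pull, mfderiv_id]
      rfl
    rw [hφ, map_smul] at h1
    nth_rewrite 2 [← h1]
    rw [smul_smul, ← Real.exp_add, neg_add_cancel, Real.exp_zero, one_smul]

end Oscillation

section Basic

variable {E : Type*} [NormedAddCommGroup E] [NormedSpace ℝ E] {H : Type*} [TopologicalSpace H]
  {M : Type*} [TopologicalSpace M] [ChartedSpace H M] {I : ModelWithCorners ℝ E H}
  [IsManifold I ∞ M] [I.Boundaryless]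

lemma LieAffinePair.extD_combination_apply (P : LieAffinePair I M) (a b : Form I M 0) (x : M)
    (v w : E) :
    (extD I (mulForm a P.ω₁ + mulForm b P.ω₂)).1 x ![v, w] =
      (extD I a).1 x (fun _ => v) * P.ω₁.1 x (fun _ => w) -
        (extD I a).1 x (fun _ => w) * P.ω₁.1 x (fun _ => v) +
      a.val x * (P.ω₂.1 x (fun _ => v) * P.ω₁.1 x (fun _ => w) -
        P.ω₂.1 x (fun _ => w) * P.ω₁.1 x (fun _ => v)) +
      ((extD I b).1 x (fun _ => v) * P.ω₂.1 x (fun _ => w) -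
        (extD I b).1 x (fun _ => w) * P.ω₂.1 x (fun _ => v)) := by
  rw [map_add, extD_mul, extD_mul, P.eq₂, mulForm_zero, add_zero, sub_eq_zero.1 P.eq₁]
  change wedge _ _ ![v, w] + a.val x * wedge _ _ ![v, w] + wedge _ _ ![v, w] = _
  simp only [wedge_one_apply]

/-- A function is basic if its differential vanishes on the tangent distribution. -/
def LieAffinePair.IsBasic (P : LieAffinePair I M) (a : Form I M 0) : Prop :=
  ∀ x (v : E), P.ω₁.1 x (fun _ => v) = 0 → P.ω₂.1 x (fun _ => v) = 0 →
    (extD I a).1 x (fun _ => v) = 0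

lemma LieAffinePair.isBasic_of_extD_combination (P : LieAffinePair I M) {a b : Form I M 0}
    (h : ∀ x (v w : E), P.ω₁.1 x (fun _ => v) = 0 → P.ω₂.1 x (fun _ => v) = 0 →
      (extD I (mulForm a P.ω₁ + mulForm b P.ω₂)).1 x ![v, w] = 0) :
    P.IsBasic a ∧ P.IsBasic b := by
  have key : ∀ x (v w : E), P.ω₁.1 x (fun _ => v) = 0 → P.ω₂.1 x (fun _ => v) = 0 →
      (extD I a).1 x (fun _ => v) * P.ω₁.1 x (fun _ => w) +
        (extD I b).1 x (fun _ => v) * P.ω₂.1 x (fun _ => w) = 0 := by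
    intro x v w h1 h2
    have h3 := h x v w h1 h2
    rw [P.extD_combination_apply, h1, h2] at h3
    linarith
  constructor
  · intro x v h1 h2
    obtain ⟨⟨w, hw1, hw2⟩, -⟩ := exists_dual_tangent (P.indep x)
    simpa [hw1, hw2] using key x v w h1 h2
  · intro x v h1 h2
    obtain ⟨-, w, hw1, hw2⟩ := exists_dual_tangent (P.indep x)
    simpa [hw1, hw2] using key x v w h1 h2

end Basic

section Periodic

lemma contDiff_infty_of_deriv {f g : ℝ → ℝ} (hg : ContDiff ℝ ∞ g)
    (hf : ∀ t, HasDerivAt f (g t) t) : ContDiff ℝ ∞ f := by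
  rw [contDiff_infty_iff_deriv]
  refine ⟨fun t => (hf t).differentiableAt, ?_⟩
  rwa [show deriv f = g from funext fun t => (hf t).deriv]

lemma exp_mul_eq_of_hasDerivAt {f : ℝ → ℝ} {lam : ℝ} (hf : ∀ t, HasDerivAt f (lam * f t) t)
    (s t : ℝ) : f s * Real.exp (-lam * s) = f t * Real.exp (-lam * t) := by
  refine is_const_of_deriv_eq_zero (f := fun t => f t * Real.exp (-lam * t)) ?_ ?_ s t
  · exact fun t => (hf t).differentiableAt.mul (by fun_prop)
  · intro t
    have h : HasDerivAt (fun t : ℝ => Real.exp (-lam * t)) (Real.exp (-lam * t) * (-lam)) t := by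
      simpa using ((hasDerivAt_id t).const_mul (-lam)).exp
    rw [((hf t).fun_mul h).deriv]
    ring

/-- The equation `f' = λ f` has no nonzero periodic solution if `λ ≠ 0`. -/
lemma eq_zero_of_hasDerivAt_of_periodic {f : ℝ → ℝ} {lam : ℝ} (hlam : lam ≠ 0)
    (hf : ∀ t, HasDerivAt f (lam * f t) t) (hper : ∀ t, f (t + 1) = f t) (t : ℝ) : f t = 0 := by
  have h := exp_mul_eq_of_hasDerivAt hf (t + 1) t
  rw [hper, mul_add, Real.exp_add, ← mul_assoc, mul_one] at h
  by_contra h0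
  have h1 : Real.exp (-lam) = 1 :=
    mul_left_cancel₀ (mul_ne_zero h0 (Real.exp_pos (-lam * t)).ne') (by rw [h, mul_one])
  rw [Real.exp_eq_one_iff, neg_eq_zero] at h1
  exact hlam h1

/-- The equation `k' = -λ (k + c)` with periodic `c` has a periodic solution if `λ ≠ 0`. -/
lemma exists_periodic_solution {c : ℝ → ℝ} {lam : ℝ} (hlam : lam ≠ 0) (hc : ContDiff ℝ ∞ c)
    (hper : ∀ t, c (t + 1) = c t) :
    ∃ k : ℝ → ℝ, ContDiff ℝ ∞ k ∧ (∀ t, k (t + 1) = k t) ∧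
      ∀ t, HasDerivAt k (-lam * (k t + c t)) t := by
  let g : ℝ → ℝ := fun s => -lam * c s * Real.exp (lam * s)
  have hg : ContDiff ℝ ∞ g := by fun_prop
  let G : ℝ → ℝ := fun t => ∫ s in (0 : ℝ)..t, g s
  have hG : ∀ t, HasDerivAt G (g t) t := fun t => hg.continuous.integral_hasStrictDerivAt 0 t
    |>.hasDerivAt
  have hGs : ContDiff ℝ ∞ G := contDiff_infty_of_deriv hg hG
  have hne : Real.exp (-lam) - 1 ≠ 0 := by
    rw [sub_ne_zero, Ne, Real.exp_eq_one_iff, neg_eq_zero]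
    exact hlam
  let K : ℝ := -(Real.exp (-lam) * G 1) / (Real.exp (-lam) - 1)
  let k : ℝ → ℝ := fun t => (K + G t) * Real.exp (-lam * t)
  have hexp : ∀ t, HasDerivAt (fun t : ℝ => Real.exp (-lam * t))
      (Real.exp (-lam * t) * (-lam)) t := fun t => by
    simpa using ((hasDerivAt_id t).const_mul (-lam)).exp
  have hk : ∀ t, HasDerivAt k (-lam * (k t + c t)) t := by
    intro t
    have h := ((hG t).const_add K).fun_mul (hexp t)
    refine h.congr_deriv ?_
    have h1 : Real.exp (lam * t) * Real.exp (-lam * t) = 1 := by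
      rw [← Real.exp_add, neg_mul, add_neg_cancel, Real.exp_zero]
    simp only [g, k]
    linear_combination (-lam * c t) * h1
  refine ⟨k, by fun_prop, fun t => ?_, hk⟩
  let d : ℝ → ℝ := fun t => k (t + 1) - k t
  have hd : ∀ t, HasDerivAt d (-lam * d t) t := by
    intro t
    refine (((hk (t + 1)).comp_add_const t 1).sub (hk t)).congr_deriv ?_
    simp only [d, hper]
    ring
  have hd0 : d 0 = 0 := by
    have hG0 : G 0 = 0 := intervalIntegral.integral_same
    have hK : K * (Real.exp (-lam) - 1) = -(Real.exp (-lam) * G 1) := div_mul_cancel₀ _ hne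
    simp only [d, k, zero_add, hG0, mul_one, mul_zero, Real.exp_zero, add_zero]
    linear_combination hK
  have h := exp_mul_eq_of_hasDerivAt hd t 0
  rw [hd0, zero_mul] at h
  exact sub_eq_zero.1 ((mul_eq_zero.1 h).resolve_right (Real.exp_pos _).ne')

end Periodic

namespace MappingTorus

section Model

variable {E : Type*} [NormedAddCommGroup E] [NormedSpace ℝ E] {H : Type*}
  [TopologicalSpace H] {I : ModelWithCorners ℝ E H} {L : Type*} [TopologicalSpace L]
  [ChartedSpace H L] [T2Space L] [CompactSpace L] [IsManifold I ∞ L] [I.Boundaryless]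
  (φ : L ≃ₘ⟮I, I⟯ L)

/-- The differential of the quotient map `L × ℝ → 𝕋_φ`. -/
noncomputable def dproj (p : Cover φ) : E × ℝ →L[ℝ] E × ℝ :=
  mfderiv (I.prod 𝓘(ℝ, ℝ)) (I.prod 𝓘(ℝ, ℝ)) (proj φ) p

variable {φ}

/-- The point `(x, t)` of `L × ℝ`. -/
def coverMk (x : L) (t : ℝ) : Cover φ := (x, t)

lemma ext_dproj {w w' : Form (I.prod 𝓘(ℝ, ℝ)) (MappingTorus φ) 1}
    (h : ∀ (p : Cover φ) (v : E × ℝ), w.1 (proj φ p) (fun _ => dproj φ p v) =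
      w'.1 (proj φ p) (fun _ => dproj φ p v)) : w = w' :=
  pullForm_proj_injective φ (Form.ext_covector h)

lemma pull_val (a : Form (I.prod 𝓘(ℝ, ℝ)) (MappingTorus φ) 0) (p : Cover φ) :
    (pullForm (proj φ) (contMDiff_proj φ) a).val p = a.val (proj φ p) := zval_comp _ _

lemma extD_apply_dproj {a : Form (I.prod 𝓘(ℝ, ℝ)) (MappingTorus φ) 0} {A : ℝ → ℝ}
    (hA : ContDiff ℝ ∞ A) (ha : ∀ p : Cover φ, a.val (proj φ p) = A p.2) (p : Cover φ)
    (v : E × ℝ) :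
    (extD (I.prod 𝓘(ℝ, ℝ)) a).1 (proj φ p) (fun _ => dproj φ p v) = deriv A p.2 * v.2 := by
  have hs : ContMDiff (I.prod 𝓘(ℝ, ℝ)) 𝓘(ℝ, ℝ) ∞ (fun p : Cover φ => A p.2) :=
    hA.contMDiff.comp (contMDiff_snd' φ)
  have h1 : pullForm (proj φ) (contMDiff_proj φ) a = ofFun _ hs :=
    Form.ext_val fun q => by rw [pull_val, ha, val_ofFun]
  have h2 : (extD (I.prod 𝓘(ℝ, ℝ)) a).1 (proj φ p) (fun _ => dproj φ p v) =
      (extD (I.prod 𝓘(ℝ, ℝ)) (ofFun _ hs)).1 p (fun _ => v) := by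
    rw [← h1, pullForm_extD]
    rfl
  have h5 : HasMFDerivAt (I.prod 𝓘(ℝ, ℝ)) 𝓘(ℝ, ℝ) (fun p : Cover φ => p.2) p
      (mfderiv (I.prod 𝓘(ℝ, ℝ)) 𝓘(ℝ, ℝ) (fun p : Cover φ => p.2) p) :=
    ((contMDiff_snd' φ).mdifferentiableAt (by simp)).hasMFDerivAt
  have hd : HasDerivAt A (deriv A p.2) p.2 :=
    (hA.differentiable (by simp) p.2).hasDerivAt
  have h3 : HasMFDerivAt (I.prod 𝓘(ℝ, ℝ)) 𝓘(ℝ, ℝ) (fun p : Cover φ => A p.2) p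
      ((ContinuousLinearMap.toSpanSingleton ℝ (deriv A p.2)) ∘L
        mfderiv (I.prod 𝓘(ℝ, ℝ)) 𝓘(ℝ, ℝ) (fun p : Cover φ => p.2) p) :=
    HasMFDerivAt.comp (I' := 𝓘(ℝ, ℝ)) (g := A)
      (f := fun p : Cover φ => p.2) p hd.hasFDerivAt.hasMFDerivAt h5
  rw [h2, extD_ofFun, h3.mfderiv, mfderiv_snd']
  change v.2 * deriv A p.2 = _
  ring

/-- A periodic function of `t` defines a function on `𝕋_φ`. -/
lemma exists_form_of_periodic {A : ℝ → ℝ} (hA : ContDiff ℝ ∞ A) (hper : ∀ t, A (t + 1) = A t) :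
    ∃ a : Form (I.prod 𝓘(ℝ, ℝ)) (MappingTorus φ) 0, ∀ p : Cover φ, a.val (proj φ p) = A p.2 := by
  have hs : ContMDiff (I.prod 𝓘(ℝ, ℝ)) 𝓘(ℝ, ℝ) ∞ (fun p : Cover φ => A p.2) :=
    hA.contMDiff.comp (contMDiff_snd' φ)
  have hinv : pullForm (fun p : Cover φ => (1 : ℤ) +ᵥ p) (Cover.contMDiff_vadd φ 1)
      (ofFun _ hs) = ofFun _ hs := Form.ext_val fun q => by
    refine (zval_comp _ _).trans ?_
    change A ((1 : ℤ) +ᵥ q).2 = A q.2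
    rw [Cover.one_vadd, hper]
  exact ⟨descendForm φ _ hinv, fun p => by rw [← pull_val, pullForm_descendForm, val_ofFun]⟩

variable {α : Form I L 1} {lam : ℝ} {hα : extD I α = 0} {hne : ∀ x, α.covector x ≠ 0}
  {hφ : pullForm φ φ.contMDiff α = Real.exp lam • α} {hlam : lam ≠ 0}

lemma modelPair_ω₁_apply (p : Cover φ) (v : E × ℝ) :
    (modelPair φ α lam hα hne hφ hlam).ω₁.1 (proj φ p) (fun _ => dproj φ p v) =
      Real.exp (-lam * p.2) * α.1 p.1 (fun _ => v.1) := by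
  rw [← coverForm₁_apply φ α lam p (fun _ => v),
    ← pullForm_descendForm φ (coverForm₁ φ α lam) (coverForm₁_invariant φ hφ)]
  rfl

lemma modelPair_ω₂_apply (p : Cover φ) (v : E × ℝ) :
    (modelPair φ α lam hα hne hφ hlam).ω₂.1 (proj φ p) (fun _ => dproj φ p v) = -lam * v.2 := by
  rw [← coverForm₂_apply φ lam p (fun _ => v),
    ← pullForm_descendForm φ (coverForm₂ φ lam) (coverForm₂_invariant φ lam)]
  rfl

/-- Basic functions of the model foliation are functions of `t`. -/
lemma exists_eq_of_isBasic [ConnectedSpace L] {a : Form (I.prod 𝓘(ℝ, ℝ)) (MappingTorus φ) 0}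
    (ha : (modelPair φ α lam hα hne hφ hlam).IsBasic a) :
    ∃ A : ℝ → ℝ, ContDiff ℝ ∞ A ∧ (∀ p : Cover φ, a.val (proj φ p) = A p.2) ∧
      ∀ t, A (t + 1) = A t := by
  obtain ⟨x₀⟩ := (inferInstance : Nonempty L)
  let A : ℝ → ℝ := fun t => a.val (proj φ (coverMk x₀ t))
  have hA : ∀ p : Cover φ, a.val (proj φ p) = A p.2 := by
    intro p
    obtain ⟨x, t, rfl⟩ : ∃ x t, coverMk x t = p := ⟨p.1, p.2, rfl⟩
    have hi : ContMDiff I (I.prod 𝓘(ℝ, ℝ)) ∞ (fun x : L => coverMk (φ := φ) x t) :=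
      contMDiff_id.prodMk (contMDiff_const (c := t))
    let f := pullForm (fun x : L => coverMk (φ := φ) x t) hi
      (pullForm (proj φ) (contMDiff_proj φ) a)
    have hf : ∀ x, f.val x = a.val (proj φ (coverMk x t)) := fun x => by
      rw [← pull_val]
      exact zval_comp _ _
    change a.val (proj φ (coverMk x t)) = a.val (proj φ (coverMk x₀ t))
    rw [← hf, ← hf]
    refine val_eq_of_conformal hne φ hlam hφ f (fun y u hu => ?_) x x₀
    have hd : mfderiv I (I.prod 𝓘(ℝ, ℝ)) (fun x : L => coverMk (φ := φ) x t) y = ContinuousLinearMap.inl ℝ E ℝ :=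
      mfderiv_prod_left (M := L) (M' := ℝ)
    have h1 : (extD I f).1 y (fun _ => u) =
        (extD (I.prod 𝓘(ℝ, ℝ)) a).1 (proj φ (coverMk y t)) (fun _ => dproj φ (coverMk y t)
          ((mfderiv I (I.prod 𝓘(ℝ, ℝ)) (fun x : L => coverMk (φ := φ) x t) y : E →L[ℝ] E × ℝ) u)) := by
      simp only [f]
      rw [pullForm_extD, pullForm_extD]
      rfl
    rw [h1, hd]
    refine ha _ _ ?_ ?_
    · refine (modelPair_ω₁_apply _ _).trans ?_
      change _ * α.1 y (fun _ => u) = 0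
      rw [hu, mul_zero]
    · refine (modelPair_ω₂_apply _ _).trans ?_
      change -lam * 0 = 0
      rw [mul_zero]
  refine ⟨A, ?_, hA, fun t => ?_⟩
  · have hj : ContMDiff 𝓘(ℝ, ℝ) (I.prod 𝓘(ℝ, ℝ)) ∞ (fun t : ℝ => coverMk (φ := φ) x₀ t) :=
      (contMDiff_const (c := x₀)).prodMk contMDiff_id
    let f := pullForm (fun t : ℝ => coverMk (φ := φ) x₀ t) hj
      (pullForm (proj φ) (contMDiff_proj φ) a)
    have h1 : ∀ t, zval ℝ (inChart 𝓘(ℝ, ℝ) (0 : ℝ) f.1 t) = A t := by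
      intro t
      refine (zval_comp _ _).trans ?_
      refine (zval_comp _ _).trans ?_
      refine (zval_comp _ _).trans ?_
      rfl
    have h2 := f.2 0
    rw [extChartAt_model_space_eq_id, PartialEquiv.refl_target, contDiffOn_univ] at h2
    have h3 := (zval ℝ).contDiff.comp h2
    rwa [show zval ℝ ∘ inChart 𝓘(ℝ, ℝ) (0 : ℝ) f.1 = A from funext h1] at h3
  · have h1 := hA ((1 : ℤ) +ᵥ coverMk (φ := φ) x₀ t)
    rw [proj_vadd, Cover.one_vadd, hA] at h1
    exact h1.symm

/-- Any pair defining the model foliation is gauge equivalent to the model pair. -/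
lemma gaugeEquivalent_of_tangentDistribution_eq [ConnectedSpace L]
    {Z : LieAffinePair (I.prod 𝓘(ℝ, ℝ)) (MappingTorus φ)}
    (hZ : Z.tangentDistribution = (modelPair φ α lam hα hne hφ hlam).tangentDistribution) :
    GaugeEquivalent (modelPair φ α lam hα hne hφ hlam) Z := by
  set P := modelPair φ α lam hα hne hφ hlam
  obtain ⟨a₁, b₁, h₁⟩ := P.exists_coefficients Z.ω₁ (fun x => hZ ▸ inf_le_left)
  obtain ⟨a₂, b₂, h₂⟩ := P.exists_coefficients Z.ω₂ (fun x => hZ ▸ inf_le_right)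
  have e₁ : ∀ y v, Z.ω₁.1 y v = a₁.val y * P.ω₁.1 y v + b₁.val y * P.ω₂.1 y v := fun y v => by
    rw [h₁]; rfl
  have e₂ : ∀ y v, Z.ω₂.1 y v = a₂.val y * P.ω₁.1 y v + b₂.val y * P.ω₂.1 y v := fun y v => by
    rw [h₂]; rfl
  have d₁ : ∀ y v w, (extD _ (mulForm a₁ P.ω₁ + mulForm b₁ P.ω₂)).1 y ![v, w] =
      Z.ω₂.1 y (fun _ => v) * Z.ω₁.1 y (fun _ => w) -
        Z.ω₂.1 y (fun _ => w) * Z.ω₁.1 y (fun _ => v) := fun y v w => by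
    rw [← h₁, sub_eq_zero.1 Z.eq₁]
    exact wedge_one_apply _ _ v w
  have d₂ : ∀ y v w, (extD _ (mulForm a₂ P.ω₁ + mulForm b₂ P.ω₂)).1 y ![v, w] = 0 :=
    fun y v w => by
      rw [← h₂, Z.eq₂]
      rfl
  obtain ⟨ha₁, hb₁⟩ := P.isBasic_of_extD_combination (a := a₁) (b := b₁) fun y v w hv hv' => by
    rw [d₁, e₁, e₁, e₂, e₂, hv, hv']
    ring
  obtain ⟨ha₂, hb₂⟩ := P.isBasic_of_extD_combination (a := a₂) (b := b₂)
    fun y v w _ _ => d₂ y v w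
  obtain ⟨A₁, sA₁, hA₁, pA₁⟩ := exists_eq_of_isBasic ha₁
  obtain ⟨B₁, sB₁, hB₁, pB₁⟩ := exists_eq_of_isBasic hb₁
  obtain ⟨A₂, sA₂, hA₂, pA₂⟩ := exists_eq_of_isBasic ha₂
  obtain ⟨B₂, sB₂, hB₂, pB₂⟩ := exists_eq_of_isBasic hb₂
  obtain ⟨x₀⟩ := (inferInstance : Nonempty L)
  obtain ⟨u, hu⟩ : ∃ u : E, α.1 x₀ (fun _ => u) ≠ 0 := by
    by_contra! h0
    exact hne x₀ (ContinuousLinearMap.ext h0)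
  have hα0 : ∀ x : L, α.1 x (fun _ => (0 : E)) = 0 := fun x => (α.1 x).map_coord_zero 0 rfl
  have odeA₂ : ∀ t, deriv A₂ t = lam * A₂ t := by
    intro t
    obtain ⟨p, hp1, hp2⟩ : ∃ p : Cover φ, p.1 = x₀ ∧ p.2 = t := ⟨coverMk x₀ t, rfl, rfl⟩
    have h := d₂ (proj φ p) (dproj φ p (u, 0)) (dproj φ p (0, 1))
    rw [P.extD_combination_apply, extD_apply_dproj sA₂ hA₂, extD_apply_dproj sA₂ hA₂,
      extD_apply_dproj sB₂ hB₂, extD_apply_dproj sB₂ hB₂, hA₂, modelPair_ω₁_apply,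
      modelPair_ω₁_apply, modelPair_ω₂_apply, modelPair_ω₂_apply] at h
    simp only [hα0, hp1, hp2] at h
    refine mul_right_cancel₀ (mul_ne_zero (Real.exp_pos (-lam * t)).ne' hu) ?_
    linear_combination -h
  have zA₂ : ∀ t, A₂ t = 0 := eq_zero_of_hasDerivAt_of_periodic hlam
    (fun t => odeA₂ t ▸ (sA₂.differentiable (by simp) t).hasDerivAt) pA₂
  have odeA₁ : ∀ t, deriv A₁ t = lam * A₁ t * (1 - B₂ t) := by
    intro t
    obtain ⟨p, hp1, hp2⟩ : ∃ p : Cover φ, p.1 = x₀ ∧ p.2 = t := ⟨coverMk x₀ t, rfl, rfl⟩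
    have h := d₁ (proj φ p) (dproj φ p (u, 0)) (dproj φ p (0, 1))
    rw [P.extD_combination_apply, e₁, e₁, e₂, e₂, extD_apply_dproj sA₁ hA₁,
      extD_apply_dproj sA₁ hA₁, extD_apply_dproj sB₁ hB₁, extD_apply_dproj sB₁ hB₁, hA₁, hB₁,
      hA₂, hB₂, modelPair_ω₁_apply,
      modelPair_ω₁_apply, modelPair_ω₂_apply, modelPair_ω₂_apply] at h
    simp only [hα0, zA₂, hp1, hp2] at h
    refine mul_right_cancel₀ (mul_ne_zero (Real.exp_pos (-lam * t)).ne' hu) ?_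
    linear_combination -h
  have nA₁ : ∀ t, A₁ t ≠ 0 := by
    intro t h0
    obtain ⟨p, hp1, hp2⟩ : ∃ p : Cover φ, p.1 = x₀ ∧ p.2 = t := ⟨coverMk x₀ t, rfl, rfl⟩
    obtain ⟨⟨v, hv1, hv2⟩, w, hw2, -⟩ := exists_dual_tangent (Z.indep (proj φ p))
    rw [e₁, hA₁, hB₁] at hv1
    rw [e₂, hA₂, hB₂] at hv2 hw2
    simp only [hp2, h0, zA₂, zero_mul, zero_add] at hv1 hv2 hw2
    have h2 := right_ne_zero_of_mul (hv1.trans_ne one_ne_zero)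
    rw [(mul_eq_zero.1 hv2).resolve_right h2, zero_mul] at hw2
    exact zero_ne_one hw2
  obtain ⟨k, sk, pk, hk⟩ := exists_periodic_solution (c := fun t => B₁ t / A₁ t) hlam
    (sB₁.div sA₁ nA₁) (fun t => by rw [pA₁, pB₁])
  obtain ⟨h, hh⟩ := exists_form_of_periodic (φ := φ) sk pk
  obtain ⟨b, hb⟩ := exists_form_of_periodic (φ := φ) (A := fun t => (A₁ t)⁻¹) (sA₁.inv nA₁)
    (fun t => by rw [pA₁])
  refine ⟨a₁, b, h, fun y => ?_, ext_dproj fun p v => ?_, ext_dproj fun p v => ?_⟩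
  · obtain ⟨p, rfl⟩ := proj_surjective φ y
    rw [hA₁, hb, mul_inv_cancel₀ (nA₁ _)]
  · have h1 : (mulForm a₁ (Z.ω₂ - P.ω₂)).1 (proj φ p) (fun _ => dproj φ p v) =
        a₁.val (proj φ p) * (Z.ω₂.1 (proj φ p) (fun _ => dproj φ p v) -
          P.ω₂.1 (proj φ p) (fun _ => dproj φ p v)) := rfl
    rw [h1, extD_apply_dproj sA₁ hA₁, odeA₁, e₂, hA₁, hA₂, hB₂, zA₂, modelPair_ω₂_apply]
    ring
  · have h1 : (mulForm a₁ (P.ω₁ + mnD P.ω₂ 0 h)).1 (proj φ p) (fun _ => dproj φ p v) =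
        a₁.val (proj φ p) * (P.ω₁.1 (proj φ p) (fun _ => dproj φ p v) +
          ((extD _ h).1 (proj φ p) (fun _ => dproj φ p v) -
            h.val (proj φ p) * P.ω₂.1 (proj φ p) (fun _ => dproj φ p v))) := by
      rw [mnD_apply, wedgeForm_zeroForm]
      rfl
    rw [h1, extD_apply_dproj sk hh, (hk _).deriv, e₁, hA₁, hB₁, hh, modelPair_ω₁_apply,
      modelPair_ω₂_apply]
    have := nA₁ p.2
    field_simp
    ring

end Model

end MappingTorus

end LieAffine

theorem mainTheorem9 {n : ℕ} {L : Type*} [TopologicalSpace L] [T2Space L] [CompactSpace L]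
    [ConnectedSpace L] [ChartedSpace (EuclideanSpace ℝ (Fin n)) L] [IsManifold (𝓡 n) ∞ L]
    (φ : L ≃ₘ⟮𝓡 n, 𝓡 n⟯ L) (α : LieAffine.Form (𝓡 n) L 1) (lam : ℝ)
    (hα : LieAffine.extD (𝓡 n) α = 0) (hne : ∀ x, α.covector x ≠ 0)
    (hφ : LieAffine.pullForm φ φ.contMDiff α = Real.exp lam • α) (hlam : lam ≠ 0) :
    (∀ Z : LieAffine.LieAffinePair ((𝓡 n).prod 𝓘(ℝ, ℝ)) (LieAffine.MappingTorus φ),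
      Z.tangentDistribution =
          (LieAffine.MappingTorus.modelPair φ α lam hα hne hφ hlam).tangentDistribution →
        ((LieAffine.MappingTorus.modelPair φ α lam hα hne hφ hlam).CohomologicalConditions ↔
          Z.CohomologicalConditions)) ∧
    (∀ Z Z' : LieAffine.LieAffinePair ((𝓡 n).prod 𝓘(ℝ, ℝ)) (LieAffine.MappingTorus φ),
      Z.tangentDistribution =
          (LieAffine.MappingTorus.modelPair φ α lam hα hne hφ hlam).tangentDistribution →
        Z'.tangentDistribution = Z.tangentDistribution →
          (Z.CohomologicalConditions ↔ Z'.CohomologicalConditions)) := by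
  have hZ := fun (Z : LieAffine.LieAffinePair ((𝓡 n).prod 𝓘(ℝ, ℝ)) (LieAffine.MappingTorus φ))
    (h : Z.tangentDistribution =
      (LieAffine.MappingTorus.modelPair φ α lam hα hne hφ hlam).tangentDistribution) =>
    (LieAffine.MappingTorus.gaugeEquivalent_of_tangentDistribution_eq h).cohomologicalConditions_iff
  exact ⟨hZ, fun Z Z' h h' => (hZ Z h).symm.trans (hZ Z' (h'.trans h))⟩
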